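/- Let $\Gamma=\mathbb{Z}^d$ carry a translation-invariant metric $|x-y|$, let $\ell\ge 1$, and let $\mathfrak{A}(\Lambda)=\bigotimes_{x\in\Lambda}M_\ell(\mathbb{C})$ for finite $\Lambda\subset\Gamma$, with quasilocal algebra $\mathfrak{A}$, the $C^*$-completion of $\bigcup_\Lambda\mathfrak{A}(\Lambda)$. Let $F:[0,\infty)\to(0,\infty)$ be non-increasing with $\sum_{x\in\Gamma}F(|x|)<\infty$ and $\sup_{x,y\in\Gamma}\sum_{z\in\Gamma}F(|z-x|)F(|y-z|)/F(|y-x|)<\infty$. Let $\Phi$ be a translation-invariant interaction, that is, $\Phi(X)=\Phi(X)^*\in\mathfrak{A}(X)$ for every finite $X\subset\Gamma$ and $\Phi(X+a)$ is the translate of $\Phi(X)$ by $a\in\Gamma$, such that for some $\lambda>0$ $$\sup_{x\in\Gamma}\ \sum_{X\ni x,0}\frac{\|\Phi(X)\|}{e^{-\lambda|x|}F(|x|)}<\infty .$$ Put $H_\Lambda=\sum_{X\subset\Lambda}\Phi(X)$ and $\tau^\Lambda_t(A)=e^{itH_\Lambda}Ae^{-itH_\Lambda}$, and let $\tau_t(A)=\lim_{\Lambda\nearrow\Gamma}\tau^\Lambda_t(A)$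 (norm limit) be the global dynamics on $\mathfrak{A}$. For every finite $\Lambda\subset\Gamma$ let $E_\Lambda=\min\mathrm{Sp}(H_\Lambda)$, let $\psi_\Lambda\in\bigotimes_{x\in\Lambda}\mathbb{C}^\ell$ be a unit vector with $H_\Lambda\psi_\Lambda=E_\Lambda\psi_\Lambda$, and let $\omega_\Lambda$ be a state on $\mathfrak{A}$ with $\omega_\Lambda(A)=\langle\psi_\Lambda,A\psi_\Lambda\rangle$ for all $A\in\mathfrak{A}(\Lambda)$. Let $\omega$ be a weak-$*$ limit point of the net $(\omega_\Lambda)$ as $\Lambda\nearrow\Gamma$, and let $(\mathcal{H},\pi,\Omega)$ be its GNS triple. The GNS Hamiltonian $H$ is the generator of the strongly continuous unitary group $U(t)=e^{itH}$ on $\mathcal{H}$ with $U(t)\pi(A)U(t)^*=\pi(\tau_t(A))$ and $U(t)\Omega=\Omega$ for all $t\in\mathbb{R}$, $A\in\mathfrak{A}$. Let $E\in\mathbb{R}$ be such that for some $\epsilon>0$ and some finite $\Lambda_0\subset\Gamma$, $$\big(E_\Lambda+(E-\epsilon,E+\epsilon)\big)\cap\mathrm{Sp}(H_\Lambda)=\emptyset\qquad\text{for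 all finite }\Lambda\supset\Lambda_0 .$$ Then the GNS Hamiltonian $H$ exists and is unique, and $E\notin\mathrm{Sp}(H)$. Moreover, $(E-\epsilon,E+\epsilon)\cap\mathrm{Sp}(H)=\emptyset$, so uniform finite-volume gaps do not close in the thermodynamic limit. -/

import Mathlib

open Filter Topology
open scoped ComplexOrder InnerProductSpace ENNReal

noncomputable section

namespace SpinLattice

/-! ### Spin configurations and local matrix algebras -/

/-- The lattice `ℤ ^ d` of sites. -/
abbrev Site (d : ℕ) : Type := Fin d → ℤ

/-- Spin configurations on a finite region `Λ`; they label the product basis of the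
finite-volume Hilbert space `⨂_{x ∈ Λ} ℂ ^ ℓ`. -/
abbrev LocalConfig {d : ℕ} (ℓ : ℕ) (Λ : Finset (Site d)) : Type := Λ → Fin ℓ

/-- The finite-volume Hilbert space `⨂_{x ∈ Λ} ℂ ^ ℓ`, written in its product basis. -/
abbrev LocalSpace {d : ℕ} (ℓ : ℕ) (Λ : Finset (Site d)) : Type :=
  EuclideanSpace ℂ (LocalConfig ℓ Λ)

/-- The local algebra `𝔄(Λ) = ⨂_{x ∈ Λ} M_ℓ(ℂ)`, written as the algebra of matrices
indexed by the product basis. -/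
abbrev LocalAlg {d : ℕ} (ℓ : ℕ) (Λ : Finset (Site d)) : Type :=
  Matrix (LocalConfig ℓ Λ) (LocalConfig ℓ Λ) ℂ

/-- Spin configurations on the whole lattice. -/
abbrev Config (d ℓ : ℕ) : Type := Site d → Fin ℓ

/-- The embedding `A ↦ A ⊗ 1_{Λ ∖ X}` of `𝔄(X)` into `𝔄(Λ)` for `X ⊆ Λ`. -/
def extendMatrix {d ℓ : ℕ} {X Λ : Finset (Site d)} (h : X ⊆ Λ) (A : LocalAlg ℓ X) :
    LocalAlg ℓ Λ :=
  Matrix.of fun σ s =>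
    if ∀ x : Λ, x.1 ∉ X → σ x = s x then
      A (fun x => σ ⟨x.1, h x.2⟩) (fun x => s ⟨x.1, h x.2⟩)
    else 0

/-- The translation `τ_a : 𝔄(X) → 𝔄(X + a)`: pull configurations on `X + a` back to `X`. -/
def translateMatrix {d ℓ : ℕ} (a : Site d) {X : Finset (Site d)} (A : LocalAlg ℓ X) :
    LocalAlg ℓ (X.map (addRightEmbedding a)) :=
  A.submatrix
    (fun σ x => σ ⟨x.1 + a, Finset.mem_map_of_mem (addRightEmbedding a) x.2⟩)
    (fun σ x => σ ⟨x.1 + a, Finset.mem_map_of_mem (addRightEmbedding a) x.2⟩)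

/-! ### The quasilocal algebra

The algebras `𝔄(Λ)` act faithfully and compatibly (`A` acts as `A ⊗ 1`) on the Hilbert space
`ℓ²(Config d ℓ)`. The operator norm is then the unique C⋆-norm on the union of the local algebras,
and the norm closure of this union is its C⋆-completion. -/

/-- The restriction of a configuration to `Λ`. -/
def restrictConfig {d ℓ : ℕ} (Λ : Finset (Site d)) (σ : Config d ℓ) : LocalConfig ℓ Λ :=
  fun x => σ x.1

/-- The configuration that equals `s` on `Λ` and `σ` outside `Λ`. -/
def glue {d ℓ : ℕ} (Λ : Finset (Site d)) (σ : Config d ℓ) (s : LocalConfig ℓ Λ) : Config d ℓ :=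
  fun x => if h : x ∈ Λ then s ⟨x, h⟩ else σ x

lemma restrictConfig_glue {d ℓ : ℕ} (Λ : Finset (Site d)) (σ : Config d ℓ)
    (s : LocalConfig ℓ Λ) : restrictConfig Λ (glue Λ σ s) = s := by
  funext x; simp [restrictConfig, glue]

lemma glue_glue {d ℓ : ℕ} (Λ : Finset (Site d)) (σ : Config d ℓ) (s t : LocalConfig ℓ Λ) :
    glue Λ (glue Λ σ s) t = glue Λ σ t := by
  funext x; by_cases h : x ∈ Λ <;> simp [glue, h]

lemma glue_restrictConfig {d ℓ : ℕ} (Λ : Finset (Site d)) (σ : Config d ℓ) :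
    glue Λ σ (restrictConfig Λ σ) = σ := by
  funext x; by_cases h : x ∈ Λ <;> simp [glue, restrictConfig, h]

/-- The involution `(σ, s) ↦ (σ with its restriction replaced by s, old restriction)`. -/
def exchange {d : ℕ} (ℓ : ℕ) (Λ : Finset (Site d)) :
    Config d ℓ × LocalConfig ℓ Λ ≃ Config d ℓ × LocalConfig ℓ Λ where
  toFun p := (glue Λ p.1 p.2, restrictConfig Λ p.1)
  invFun p := (glue Λ p.1 p.2, restrictConfig Λ p.1)
  left_inv p := by simp [restrictConfig_glue, glue_glue, glue_restrictConfig]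
  right_inv p := by simp [restrictConfig_glue, glue_glue, glue_restrictConfig]

/-- The Hilbert space `ℓ²` over all configurations of the lattice. -/
abbrev ConfigSpace (d ℓ : ℕ) : Type := lp (fun _ : Config d ℓ => ℂ) 2

/-- The action of `A ⊗ 1` on functions of configurations. -/
def actFun {d ℓ : ℕ} (Λ : Finset (Site d)) (A : LocalAlg ℓ Λ) (f : Config d ℓ → ℂ) :
    Config d ℓ → ℂ :=
  fun σ => ∑ s, A (restrictConfig Λ σ) s * f (glue Λ σ s)

lemma summable_sq {d ℓ : ℕ} (f : ConfigSpace d ℓ) : Summable fun σ => ‖f σ‖ ^ 2 := by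
  have h := (lp.memℓp f).summable (by norm_num)
  simpa using h

lemma norm_sq_eq {d ℓ : ℕ} (f : ConfigSpace d ℓ) : ‖f‖ ^ 2 = ∑' σ, ‖f σ‖ ^ 2 := by
  have h := lp.norm_rpow_eq_tsum (p := 2) (by norm_num) f
  simpa using h

lemma hasSum_glue {d ℓ : ℕ} (Λ : Finset (Site d)) (f : ConfigSpace d ℓ) :
    HasSum (fun σ => ∑ s, ‖f (glue Λ σ s)‖ ^ 2)
      (Fintype.card (LocalConfig ℓ Λ) * ‖f‖ ^ 2) := by
  have h0 : HasSum (fun σ => ‖f σ‖ ^ 2) (‖f‖ ^ 2) := by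
    rw [norm_sq_eq]; exact (summable_sq f).hasSum
  have hs : Summable fun p : Config d ℓ × LocalConfig ℓ Λ => ‖f p.1‖ ^ 2 := by
    refine (summable_prod_of_nonneg (fun _ => by positivity)).2
      ⟨fun σ => (hasSum_fintype _).summable, ?_⟩
    simpa using (summable_sq f).mul_left (Fintype.card (LocalConfig ℓ Λ) : ℝ)
  have h1 : HasSum (fun p : Config d ℓ × LocalConfig ℓ Λ => ‖f p.1‖ ^ 2)
      (Fintype.card (LocalConfig ℓ Λ) * ‖f‖ ^ 2) := by
    have h2 := hs.hasSum.prod_fiberwise fun σ => hasSum_fintype _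
    have h3 : HasSum (fun σ => ∑ _s : LocalConfig ℓ Λ, ‖f σ‖ ^ 2)
        (Fintype.card (LocalConfig ℓ Λ) * ‖f‖ ^ 2) := by
      simpa using h0.mul_left (Fintype.card (LocalConfig ℓ Λ) : ℝ)
    rw [← h2.unique h3]
    exact hs.hasSum
  have h4 := (exchange ℓ Λ).hasSum_iff.2 h1
  exact h4.prod_fiberwise fun σ => hasSum_fintype _

lemma actFun_bound {d ℓ : ℕ} (Λ : Finset (Site d)) (A : LocalAlg ℓ Λ) (f : ConfigSpace d ℓ)
    (σ : Config d ℓ) :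
    ‖actFun Λ A f σ‖ ^ 2 ≤ (∑ r, ∑ s, ‖A r s‖ ^ 2) * ∑ s, ‖f (glue Λ σ s)‖ ^ 2 := by
  have h1 : ‖actFun Λ A f σ‖ ≤ ∑ s, ‖A (restrictConfig Λ σ) s‖ * ‖f (glue Λ σ s)‖ :=
    (norm_sum_le _ _).trans (by simp)
  calc ‖actFun Λ A f σ‖ ^ 2
      ≤ (∑ s, ‖A (restrictConfig Λ σ) s‖ * ‖f (glue Λ σ s)‖) ^ 2 := by gcongr
    _ ≤ (∑ s, ‖A (restrictConfig Λ σ) s‖ ^ 2) * ∑ s, ‖f (glue Λ σ s)‖ ^ 2 :=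
        Finset.sum_mul_sq_le_sq_mul_sq _ _ _
    _ ≤ _ := by
        refine mul_le_mul_of_nonneg_right ?_ (by positivity)
        exact Finset.single_le_sum (f := fun r => ∑ s, ‖A r s‖ ^ 2)
          (fun r _ => by positivity) (Finset.mem_univ (restrictConfig Λ σ))

lemma memℓp_actFun {d ℓ : ℕ} (Λ : Finset (Site d)) (A : LocalAlg ℓ Λ) (f : ConfigSpace d ℓ) :
    Memℓp (actFun Λ A f) 2 := by
  apply memℓp_gen
  have := Summable.of_nonneg_of_le (fun σ => by positivity) (actFun_bound Λ A f)
    ((hasSum_glue Λ f).summable.mul_left _)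
  simpa using this

/-- The operator `A ⊗ 1` on `ℓ²(Config d ℓ)` for `A ∈ 𝔄(Λ)`. -/
def localOp {d ℓ : ℕ} (Λ : Finset (Site d)) (A : LocalAlg ℓ Λ) :
    ConfigSpace d ℓ →L[ℂ] ConfigSpace d ℓ :=
  LinearMap.mkContinuousOfExistsBound
    { toFun := fun f => ⟨actFun Λ A f, memℓp_actFun Λ A f⟩
      map_add' := fun f g => by
        ext σ
        change actFun Λ A (f + g) σ = actFun Λ A f σ + actFun Λ A g σ
        simp [actFun, mul_add, Finset.sum_add_distrib]
      map_smul' := fun c f => by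
        ext σ; simp [actFun, Finset.mul_sum, mul_left_comm] }
    ⟨√((∑ r, ∑ s, ‖A r s‖ ^ 2) * Fintype.card (LocalConfig ℓ Λ)), fun f => by
      refine le_of_sq_le_sq ?_ (by positivity)
      rw [mul_pow, Real.sq_sqrt (by positivity), norm_sq_eq, mul_assoc]
      have h := (hasSum_glue Λ f).mul_left (∑ r, ∑ s, ‖A r s‖ ^ 2)
      rw [← h.tsum_eq]
      exact Summable.tsum_le_tsum (actFun_bound Λ A f) (by
        simpa using summable_sq (⟨actFun Λ A f, memℓp_actFun Λ A f⟩ : ConfigSpace d ℓ))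
        h.summable⟩

lemma localOp_apply {d ℓ : ℕ} (Λ : Finset (Site d)) (A : LocalAlg ℓ Λ) (f : ConfigSpace d ℓ)
    (σ : Config d ℓ) :
    localOp Λ A f σ = ∑ s, A (restrictConfig Λ σ) s * f (glue Λ σ s) := rfl

lemma localOp_mul {d ℓ : ℕ} (Λ : Finset (Site d)) (A B : LocalAlg ℓ Λ) :
    localOp Λ (A * B) = localOp Λ A * localOp Λ B := by
  ext f σ
  simp only [mul_apply_eq_comp, localOp_apply, restrictConfig_glue, glue_glue,
    Matrix.mul_apply, Finset.sum_mul, Finset.mul_sum]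
  rw [Finset.sum_comm]
  simp only [mul_assoc]

lemma localOp_one {d ℓ : ℕ} (Λ : Finset (Site d)) : localOp Λ (1 : LocalAlg ℓ Λ) = 1 := by
  ext f σ
  simp [localOp_apply, Matrix.one_apply, glue_restrictConfig]

lemma inner_localOp_left {d ℓ : ℕ} (Λ : Finset (Site d)) (A : LocalAlg ℓ Λ)
    (f g : ConfigSpace d ℓ) :
    HasSum (fun p : Config d ℓ × LocalConfig ℓ Λ =>
      g p.1 * starRingEnd ℂ (A (restrictConfig Λ p.1) p.2 * f (glue Λ p.1 p.2)))
      ⟪localOp Λ A f, g⟫_ℂ := by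
  have hsum : Summable (fun p : Config d ℓ × LocalConfig ℓ Λ =>
      g p.1 * starRingEnd ℂ (A (restrictConfig Λ p.1) p.2 * f (glue Λ p.1 p.2))) := by
    have hg : Summable fun p : Config d ℓ × LocalConfig ℓ Λ => ‖g p.1‖ ^ 2 := by
      refine (summable_prod_of_nonneg (fun _ => by positivity)).2
        ⟨fun σ => (hasSum_fintype _).summable, ?_⟩
      simpa using (summable_sq g).mul_left (Fintype.card (LocalConfig ℓ Λ) : ℝ)
    have hf : Summable fun p : Config d ℓ × LocalConfig ℓ Λ => ‖f (glue Λ p.1 p.2)‖ ^ 2 := by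
      refine (summable_prod_of_nonneg (fun _ => by positivity)).2
        ⟨fun σ => (hasSum_fintype _).summable, ?_⟩
      simpa using (hasSum_glue Λ f).summable
    refine Summable.of_norm_bounded
      ((hg.add hf).mul_left (∑ r, ∑ s, ‖A r s‖)) fun p => ?_
    have hA : ‖A (restrictConfig Λ p.1) p.2‖ ≤ ∑ r, ∑ s, ‖A r s‖ :=
      (Finset.single_le_sum (f := fun s => ‖A (restrictConfig Λ p.1) s‖)
        (fun s _ => norm_nonneg _) (Finset.mem_univ p.2)).trans
      (Finset.single_le_sum (f := fun r => ∑ s, ‖A r s‖)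
        (fun r _ => by positivity) (Finset.mem_univ (restrictConfig Λ p.1)))
    have h2 : ‖g p.1‖ * ‖f (glue Λ p.1 p.2)‖ ≤ ‖g p.1‖ ^ 2 + ‖f (glue Λ p.1 p.2)‖ ^ 2 := by
      nlinarith [sq_nonneg (‖g p.1‖ - ‖f (glue Λ p.1 p.2)‖), sq_nonneg ‖g p.1‖,
        sq_nonneg ‖f (glue Λ p.1 p.2)‖]
    calc ‖g p.1 * starRingEnd ℂ (A (restrictConfig Λ p.1) p.2 * f (glue Λ p.1 p.2))‖
        = ‖A (restrictConfig Λ p.1) p.2‖ * (‖g p.1‖ * ‖f (glue Λ p.1 p.2)‖) := by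
          simp only [norm_mul, RCLike.norm_conj]; ring
      _ ≤ _ := mul_le_mul hA h2 (by positivity) (by positivity)
  have h1 := hsum.hasSum.prod_fiberwise fun σ => hasSum_fintype _
  have h2 : HasSum (fun σ => ⟪(localOp Λ A f) σ, g σ⟫_ℂ) ⟪localOp Λ A f, g⟫_ℂ :=
    lp.hasSum_inner _ _
  have h3 : (fun σ => ⟪(localOp Λ A f) σ, g σ⟫_ℂ) = fun σ => ∑ s,
      g σ * starRingEnd ℂ (A (restrictConfig Λ σ) s * f (glue Λ σ s)) := by
    funext σ
    simp only [localOp_apply, RCLike.inner_apply, map_sum, Finset.mul_sum]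
  rw [h3] at h2
  rw [← h1.unique h2]
  exact hsum.hasSum

lemma localOp_star {d ℓ : ℕ} (Λ : Finset (Site d)) (A : LocalAlg ℓ Λ) :
    localOp Λ (star A) = star (localOp Λ A) := by
  rw [ContinuousLinearMap.star_eq_adjoint, ContinuousLinearMap.eq_adjoint_iff]
  intro f g
  have h1 := inner_localOp_left Λ (star A) f g
  have h2 := (exchange ℓ Λ).hasSum_iff.2 (inner_localOp_left Λ A g f)
  have h3 := (Complex.hasSum_conj'.2 h2)
  rw [inner_conj_symm] at h3
  refine h1.unique ?_
  convert h3 using 1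
  funext p
  simp [exchange, restrictConfig_glue, glue_glue, glue_restrictConfig, Matrix.star_apply]
  ring

/-- The faithful representation of `𝔄(Λ)` on `ℓ²(Config d ℓ)`. -/
def localRep {d : ℕ} (ℓ : ℕ) (Λ : Finset (Site d)) :
    LocalAlg ℓ Λ →⋆ₐ[ℂ] (ConfigSpace d ℓ →L[ℂ] ConfigSpace d ℓ) where
  toFun := localOp Λ
  map_one' := localOp_one Λ
  map_mul' := localOp_mul Λ
  map_zero' := by ext f σ; simp [localOp_apply]
  map_add' A B := by
    ext f σ
    simp [localOp_apply, add_mul, Finset.sum_add_distrib]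
  commutes' c := by
    ext f σ
    simp [localOp_apply, Matrix.algebraMap_matrix_apply, glue_restrictConfig]
  map_star' := localOp_star Λ

/-- The quasilocal algebra as a C⋆-subalgebra of `B(ℓ²(Config d ℓ))`. -/
def quasiLocalSubalgebra (d ℓ : ℕ) :
    StarSubalgebra ℂ (ConfigSpace d ℓ →L[ℂ] ConfigSpace d ℓ) :=
  (⨆ Λ : Finset (Site d), (localRep ℓ Λ).range).topologicalClosure

/-- The quasilocal algebra `𝔄`, the C⋆-completion of `⋃ Λ, 𝔄(Λ)`. -/
abbrev QuasiLocalAlgebra (d ℓ : ℕ) : Type := quasiLocalSubalgebra d ℓ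

/-- The inclusion of the local algebra `𝔄(Λ)` into the quasilocal algebra `𝔄`. -/
def localObs {d ℓ : ℕ} (Λ : Finset (Site d)) (A : LocalAlg ℓ Λ) : QuasiLocalAlgebra d ℓ :=
  ⟨localRep ℓ Λ A, StarSubalgebra.le_topologicalClosure _
    (le_iSup (fun Λ : Finset (Site d) => (localRep ℓ Λ).range) Λ ⟨A, rfl⟩)⟩

/-! ### Interactions, local Hamiltonians and the dynamics -/

/-- An interaction: a self-adjoint element `Φ(X) ∈ 𝔄(X)` for every finite `X`. -/
structure Interaction (d ℓ : ℕ) where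
  /-- the interaction terms -/
  term : (X : Finset (Site d)) → LocalAlg ℓ X
  isHermitian_term : ∀ X, (term X).IsHermitian

/-- Translation invariance: `Φ(X + a) = τ_a(Φ(X))`. -/
def Interaction.TranslationInvariant {d ℓ : ℕ} (Φ : Interaction d ℓ) : Prop :=
  ∀ (a : Site d) (X : Finset (Site d)),
    Φ.term (X.map (addRightEmbedding a)) = translateMatrix a (Φ.term X)

/-- `F : [0, ∞) → (0, ∞)` is non-increasing with `∑ₓ F(|x|) < ∞` and
`sup_{x,y} ∑_z F(|z - x|) F(|y - z|) / F(|y - x|) < ∞`. Here the metric on `ℤ ^ d` is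
`|x - y| = N (x - y)`. -/
structure IsDecayFunction {d : ℕ} (N : AddGroupNorm (Site d)) (F : ℝ → ℝ) : Prop where
  pos : ∀ r, 0 ≤ r → 0 < F r
  antitoneOn : AntitoneOn F (Set.Ici 0)
  summable : Summable fun x : Site d => F (N x)
  convolution : ∃ C : ℝ, ∀ x y : Site d,
    Summable (fun z : Site d => F (N (z - x)) * F (N (y - z)) / F (N (y - x))) ∧
    ∑' z : Site d, F (N (z - x)) * F (N (y - z)) / F (N (y - x)) ≤ C

/-- The norm `‖Φ‖_lam = sup_x ∑_{X ∋ x, 0} ‖Φ(X)‖ / F_lam(|x|)`, where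
`F_lam(r) = exp(-lam r) F(r)`, as an extended nonnegative number. -/
def Interaction.decayNorm {d ℓ : ℕ} (Φ : Interaction d ℓ) (N : AddGroupNorm (Site d))
    (F : ℝ → ℝ) (lam : ℝ) : ℝ≥0∞ :=
  ⨆ x : Site d, ∑' X : {X : Finset (Site d) // x ∈ X ∧ 0 ∈ X},
    ENNReal.ofReal (‖localObs X.1 (Φ.term X.1)‖ / (Real.exp (-lam * N x) * F (N x)))

/-- The finite-volume Hamiltonian `H_Λ = ∑_{X ⊆ Λ} Φ(X) ∈ 𝔄(Λ)`. -/
def Interaction.hamiltonian {d ℓ : ℕ} (Φ : Interaction d ℓ) (Λ : Finset (Site d)) :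
    LocalAlg ℓ Λ :=
  ∑ X ∈ Λ.powerset.attach, extendMatrix (Finset.mem_powerset.1 X.2) (Φ.term X.1)

/-- The ground state energy `E_Λ`, the smallest point of the (finite) spectrum of `H_Λ`. -/
def Interaction.groundEnergy {d ℓ : ℕ} (Φ : Interaction d ℓ) (Λ : Finset (Site d)) : ℝ :=
  sInf (spectrum ℝ (Φ.hamiltonian Λ))

/-- `ψ` is a normalized ground state vector of `H_Λ`. -/
def Interaction.IsGroundVector {d ℓ : ℕ} (Φ : Interaction d ℓ) (Λ : Finset (Site d))
    (ψ : LocalSpace ℓ Λ) : Prop :=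
  ‖ψ‖ = 1 ∧ Matrix.toEuclideanLin (Φ.hamiltonian Λ) ψ = (Φ.groundEnergy Λ : ℂ) • ψ

/-- The local dynamics `τ^Λ_t(A) = e^{i t H_Λ} A e^{-i t H_Λ}` on `𝔄`. -/
def Interaction.localDynamics {d ℓ : ℕ} (Φ : Interaction d ℓ) (Λ : Finset (Site d)) (t : ℝ)
    (A : QuasiLocalAlgebra d ℓ) : QuasiLocalAlgebra d ℓ :=
  NormedSpace.exp ((Complex.I * t) • localObs Λ (Φ.hamiltonian Λ)) * A *
    NormedSpace.exp ((-(Complex.I * t)) • localObs Λ (Φ.hamiltonian Λ))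

/-- `τ` is the global dynamics: `τ_t(A)` is the norm limit of `τ^Λ_t(A)` as `Λ ↗ ℤ ^ d`, along
the net of all finite subsets ordered by inclusion. -/
def Interaction.IsGlobalDynamics {d ℓ : ℕ} (Φ : Interaction d ℓ)
    (τ : ℝ → QuasiLocalAlgebra d ℓ → QuasiLocalAlgebra d ℓ) : Prop :=
  ∀ (t : ℝ) (A : QuasiLocalAlgebra d ℓ),
    Tendsto (fun Λ : Finset (Site d) => Φ.localDynamics Λ t A) atTop (𝓝 (τ t A))

/-! ### States and the GNS Hamiltonian -/

/-- The functional `φ` is a state on `𝔄`. -/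
def IsState {d ℓ : ℕ} (φ : WeakDual ℂ (QuasiLocalAlgebra d ℓ)) : Prop :=
  φ 1 = 1 ∧ ∀ A, 0 ≤ φ (star A * A)

/-- A GNS triple of `φ`: a representation `π` on the Hilbert space `K` with a cyclic vector `Ω`
such that `φ(A) = ⟨Ω, π(A) Ω⟩`. It is unique up to unitary equivalence. -/
structure GNSTriple {d ℓ : ℕ} (φ : WeakDual ℂ (QuasiLocalAlgebra d ℓ)) (K : Type*)
    [NormedAddCommGroup K] [InnerProductSpace ℂ K] [CompleteSpace K] where
  /-- the representation -/
  π : QuasiLocalAlgebra d ℓ →⋆ₐ[ℂ] (K →L[ℂ] K)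
  /-- the cyclic vector -/
  Ω : K
  cyclic : Dense (Set.range fun A => π A Ω)
  inner_eq : ∀ A, ⟪Ω, π A Ω⟫_ℂ = φ A

/-- A strongly continuous one-parameter group of unitaries. -/
structure IsUnitaryGroup {K : Type*} [NormedAddCommGroup K] [InnerProductSpace ℂ K]
    [CompleteSpace K] (U : ℝ → K →L[ℂ] K) : Prop where
  mem_unitary : ∀ t, U t ∈ unitary (K →L[ℂ] K)
  map_zero : U 0 = 1
  map_add : ∀ s t, U (s + t) = U s * U t
  continuous : ∀ v, Continuous fun t => U t v

/-- The generator `H` of `U(t) = e^{i t H}`: its domain consists of the `v` for which `t ↦ U(t) v`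
is differentiable at `0`, and `H v = -i (d/dt) U(t) v` at `t = 0`. -/
def generator {K : Type*} [NormedAddCommGroup K] [InnerProductSpace ℂ K]
    (U : ℝ → K →L[ℂ] K) : K →ₗ.[ℂ] K where
  domain :=
    { carrier := {v | DifferentiableAt ℝ (fun t => U t v) 0}
      add_mem' := fun {v w} hv hw => by
        simpa using DifferentiableAt.fun_add (𝕜 := ℝ) hv hw
      zero_mem' := by simp
      smul_mem' := fun c v hv => by
        simpa using DifferentiableAt.fun_const_smul (𝕜 := ℝ) hv c }
  toFun :=
    { toFun := fun v => (-Complex.I) • deriv (fun t => U t v.1) 0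
      map_add' := fun v w => by
        have h := deriv_fun_add (𝕜 := ℝ) v.2 w.2
        simp only [Submodule.coe_add, map_add, h, smul_add]
      map_smul' := fun c v => by
        have h := deriv_fun_const_smul (𝕜 := ℝ) c v.2
        simp only [Submodule.coe_smul, map_smul, h, RingHom.id_apply]
        rw [smul_comm] }

/-- The resolvent set of an unbounded operator `T`: the `z` for which `T - z` is a bijection from
the domain of `T` onto `K` with a bounded inverse `R`. -/
def unboundedResolventSet {K : Type*} [NormedAddCommGroup K] [InnerProductSpace ℂ K]
    (T : K →ₗ.[ℂ] K) : Set ℂ :=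
  {z | ∃ R : K →L[ℂ] K,
    (∀ v, ∃ h : R v ∈ T.domain, T ⟨R v, h⟩ - z • R v = v) ∧
    ∀ v : T.domain, R (T v - z • (v : K)) = v}

/-- The spectrum of an unbounded operator. -/
def unboundedSpectrum {K : Type*} [NormedAddCommGroup K] [InnerProductSpace ℂ K]
    (T : K →ₗ.[ℂ] K) : Set ℂ :=
  (unboundedResolventSet T)ᶜ

/-- `H` is the GNS Hamiltonian: the generator of the strongly continuous unitary group `U` that
implements the global dynamics in the GNS representation and leaves the cyclic vector invariant. -/
def Interaction.IsGNSHamiltonian {d ℓ : ℕ} (Φ : Interaction d ℓ)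
    {φ : WeakDual ℂ (QuasiLocalAlgebra d ℓ)} {K : Type*} [NormedAddCommGroup K]
    [InnerProductSpace ℂ K] [CompleteSpace K] (G : GNSTriple φ K) (H : K →ₗ.[ℂ] K) : Prop :=
  ∃ (τ : ℝ → QuasiLocalAlgebra d ℓ → QuasiLocalAlgebra d ℓ) (U : ℝ → K →L[ℂ] K),
    Φ.IsGlobalDynamics τ ∧ IsUnitaryGroup U ∧
    (∀ t A, U t * G.π A * star (U t) = G.π (τ t A)) ∧
    (∀ t, U t G.Ω = G.Ω) ∧
    H = generator U

end SpinLattice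

end

/-! The Hilbert spaces of different volumes cannot be compared directly, so the gap is first turned
into an inequality between expectation values of elements of `𝔄`, which survives a weak-⋆ limit.

For Re a < 0 the resolvent of the generator `H` at `i a` is `-i ∫₀^∞ e^{at} U(t) dt`. On a vector
`π(A) Ω` it gives `-i π(B) Ω` with `B = ∫₀^∞ e^{at} τ_t(A) dt`, because `U(t) π(A) Ω = π(τ_t(A)) Ω`.
In a finite volume the same integral with `τ^Λ`, applied to the ground vector, is up to a phase the
resolvent of `H_Λ - E_Λ` at `i a` applied to `A ψ_Λ`. If every point of the spectrum of `H_Λ - E_Λ`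
is at distance at least δ from `i a`, then `δ² ω_Λ(B_Λ⋆ B_Λ) ≤ ω_Λ(A⋆ A)`
(`mul_norm_integral_evalCLM_conjFlow_le`). For local `A`, dominated convergence gives `B_Λ → B` in
norm. States are contractive, so the inequality passes to ω
(`sq_mul_apply_integral_globalDynamics_le`), and since the vectors `π(A) Ω` with `A` local are
dense, it bounds the resolvent of `H` by `δ⁻¹` (`norm_laplaceResolvent_le_of_gap`).

For `E'` in the gap, δ is the distance from `E'` to the ends of the gap and `i a = E' - i δ/2`. The
resolvent bound at `i a` is then `δ⁻¹`, not merely the `2/δ` that self-adjointness gives, and the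
Neumann series reaches `E'` at distance `δ/2`.

The global dynamics comes from a Lieb-Robinson bound proved without path expansions. Commutators of
`τ^Λ_t(A)` with the matrix units of single sites obey a closed system of differential inequalities,
and the convolution condition on `F` makes the weight `∑ₓ F(|z - x|)`, with x running over the
support of `A`, reproduce itself under it. By Duhamel's formula, enlarging the volume changes the
evolved observable by at most a constant times a tail of this summable weight. Stationarity of the
ground states makes ω invariant, so the dynamics is implemented by unitaries on the GNS space. They
are determined by their values on the orbit of Ω, hence the existence and uniqueness of `H`. -/

noncomputable section

namespace SpinLattice

/-! ### Inner flows on a C⋆-algebra -/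

section ConjFlow

variable {A : Type*} [CStarAlgebra A]

/-- The flow `a ↦ e^{i t h} a e^{-i t h}`. -/
def conjFlow (h : A) (t : ℝ) (a : A) : A :=
  NormedSpace.exp ((Complex.I * t) • h) * a * NormedSpace.exp ((-(Complex.I * t)) • h)

lemma exp_mul_exp_neg_smul (h : A) (z : ℂ) :
    NormedSpace.exp (z • h) * NormedSpace.exp ((-z) • h) = 1 := by
  let _ : NormedAlgebra ℚ A := .restrictScalars ℚ ℂ A
  have := NormedSpace.exp_add_of_commute (𝔸 := A) (x := z • h) (y := (-z) • h)
    ((Commute.refl h).smul_left _ |>.smul_right _)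
  rw [← this]; simp

lemma exp_neg_mul_exp_smul (h : A) (z : ℂ) :
    NormedSpace.exp ((-z) • h) * NormedSpace.exp (z • h) = 1 := by
  simpa using exp_mul_exp_neg_smul h (-z)

lemma star_exp_I_smul {h : A} (hh : IsSelfAdjoint h) (t : ℝ) :
    star (NormedSpace.exp ((Complex.I * t) • h)) = NormedSpace.exp ((-(Complex.I * t)) • h) := by
  rw [NormedSpace.star_exp]; simp [hh.star_eq]

lemma exp_I_smul_mem_unitary {h : A} (hh : IsSelfAdjoint h) (t : ℝ) :
    NormedSpace.exp ((Complex.I * t) • h) ∈ unitary A := by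
  rw [Unitary.mem_iff, star_exp_I_smul hh]
  exact ⟨exp_neg_mul_exp_smul h _, exp_mul_exp_neg_smul h _⟩

lemma exp_neg_I_smul_mem_unitary {h : A} (hh : IsSelfAdjoint h) (t : ℝ) :
    NormedSpace.exp ((-(Complex.I * t)) • h) ∈ unitary A := by
  rw [← star_exp_I_smul hh]
  exact Unitary.star_mem (exp_I_smul_mem_unitary hh t)

lemma norm_conjFlow {h : A} (hh : IsSelfAdjoint h) (t : ℝ) (a : A) :
    ‖conjFlow h t a‖ = ‖a‖ := by
  rw [conjFlow, CStarRing.norm_mul_mem_unitary _ (exp_neg_I_smul_mem_unitary hh t),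
    CStarRing.norm_mem_unitary_mul _ (exp_I_smul_mem_unitary hh t)]

lemma conjFlow_zero (h a : A) : conjFlow h 0 a = a := by simp [conjFlow]

lemma conjFlow_add (h : A) (s t : ℝ) (a : A) :
    conjFlow h (s + t) a = conjFlow h s (conjFlow h t a) := by
  let _ : NormedAlgebra ℚ A := .restrictScalars ℚ ℂ A
  have h1 : NormedSpace.exp ((Complex.I * (s + t : ℝ)) • h) =
      NormedSpace.exp ((Complex.I * s) • h) * NormedSpace.exp ((Complex.I * t) • h) := by
    rw [← NormedSpace.exp_add_of_commute ((Commute.refl h).smul_left _ |>.smul_right _), ← add_smul]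
    push_cast; ring_nf
  have h2 : NormedSpace.exp ((-(Complex.I * (s + t : ℝ))) • h) =
      NormedSpace.exp ((-(Complex.I * t)) • h) * NormedSpace.exp ((-(Complex.I * s)) • h) := by
    rw [← NormedSpace.exp_add_of_commute ((Commute.refl h).smul_left _ |>.smul_right _), ← add_smul]
    push_cast; ring_nf
  simp only [conjFlow, h1, h2, mul_assoc]

lemma conjFlow_map_mul (h : A) (t : ℝ) (a b : A) :
    conjFlow h t (a * b) = conjFlow h t a * conjFlow h t b := by
  have := exp_neg_mul_exp_smul h (Complex.I * t)
  simp only [conjFlow, mul_assoc]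
  rw [← mul_assoc (NormedSpace.exp ((-(Complex.I * t)) • h)) (NormedSpace.exp _), this, one_mul]

lemma conjFlow_map_add (h : A) (t : ℝ) (a b : A) :
    conjFlow h t (a + b) = conjFlow h t a + conjFlow h t b := by
  simp [conjFlow, mul_add, add_mul]

lemma conjFlow_map_sub (h : A) (t : ℝ) (a b : A) :
    conjFlow h t (a - b) = conjFlow h t a - conjFlow h t b := by
  simp [conjFlow, mul_sub, sub_mul]

lemma conjFlow_map_smul (h : A) (t : ℝ) (c : ℂ) (a : A) :
    conjFlow h t (c • a) = c • conjFlow h t a := by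
  simp [conjFlow]

lemma conjFlow_map_one (h : A) (t : ℝ) : conjFlow h t 1 = 1 := by
  rw [conjFlow, mul_one, exp_mul_exp_neg_smul]

lemma conjFlow_map_star {h : A} (hh : IsSelfAdjoint h) (t : ℝ) (a : A) :
    conjFlow h t (star a) = star (conjFlow h t a) := by
  have h2 : star (NormedSpace.exp ((-(Complex.I * t)) • h)) =
      NormedSpace.exp ((Complex.I * t) • h) := by rw [← star_exp_I_smul hh, star_star]
  simp only [conjFlow, star_mul, star_exp_I_smul hh, h2, mul_assoc]

/-- Trading the sign of time for the sign of the generator extends estimates for t ≥ 0 to all times.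
-/
lemma conjFlow_neg_left (h : A) (t : ℝ) (a : A) : conjFlow (-h) t a = conjFlow h (-t) a := by
  simp [conjFlow]

lemma conjFlow_self (h : A) (t : ℝ) : conjFlow h t h = h := by
  have h1 : Commute (NormedSpace.exp ((Complex.I * t) • h)) h :=
    ((Commute.refl h).smul_left _).exp_left
  rw [conjFlow, h1.eq, mul_assoc, exp_mul_exp_neg_smul, mul_one]

lemma conjFlow_neg_conjFlow (h : A) (t : ℝ) (a : A) : conjFlow h (-t) (conjFlow h t a) = a := by
  rw [← conjFlow_add, neg_add_cancel, conjFlow_zero]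

lemma hasDerivAt_conjFlow (h a : A) (t : ℝ) :
    HasDerivAt (fun t : ℝ => conjFlow h t a) (conjFlow h t (Complex.I • (h * a - a * h))) t := by
  have e1 : HasDerivAt (fun t : ℝ => NormedSpace.exp ((Complex.I * t) • h))
      (NormedSpace.exp ((Complex.I * t) • h) * (Complex.I • h)) t := by
    have := hasDerivAt_exp_smul_const (𝕂 := ℝ) (Complex.I • h) t
    simpa [mul_comm Complex.I, mul_smul] using this
  have e2 : HasDerivAt (fun t : ℝ => NormedSpace.exp ((-(Complex.I * t)) • h))
      ((-(Complex.I • h)) * NormedSpace.exp ((-(Complex.I * t)) • h)) t := by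
    have := hasDerivAt_exp_smul_const' (𝕂 := ℝ) (-(Complex.I • h)) t
    simpa [mul_comm Complex.I, mul_smul] using this
  convert! (e1.mul_const a).mul e2 using 1
  simp only [conjFlow, smul_sub, mul_sub, sub_mul, mul_assoc, smul_mul_assoc, mul_smul_comm,
    neg_mul, mul_neg]
  abel

lemma continuous_conjFlow (h a : A) : Continuous fun t : ℝ => conjFlow h t a :=
  continuous_iff_continuousAt.2 fun t => (hasDerivAt_conjFlow h a t).continuousAt

lemma conjFlow_commutator (h : A) (t : ℝ) (a b : A) :
    conjFlow h t (a * b - b * a) =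
      conjFlow h t a * conjFlow h t b - conjFlow h t b * conjFlow h t a := by
  rw [conjFlow_map_sub, conjFlow_map_mul, conjFlow_map_mul]

/-- The flow is isometric, so its derivative has the constant norm `‖[h, a]‖`, and the mean value
inequality applies. The bound sees `h` only through this commutator, hence can be uniform in the
volume. -/
lemma norm_conjFlow_sub_self_le {h : A} (hh : IsSelfAdjoint h) (a : A) (t : ℝ) :
    ‖conjFlow h t a - a‖ ≤ ‖h * a - a * h‖ * |t| := by
  have := Convex.norm_image_sub_le_of_norm_hasDerivWithin_le (𝕜 := ℝ) (s := Set.univ)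
    (f := fun t => conjFlow h t a) (f' := fun t => conjFlow h t (Complex.I • (h * a - a * h)))
    (C := ‖h * a - a * h‖) (x := 0) (y := t)
    (fun x _ => (hasDerivAt_conjFlow h a x).hasDerivWithinAt)
    (fun x _ => by rw [norm_conjFlow hh, norm_smul]; simp) convex_univ (by simp) (by simp)
  simpa [conjFlow_zero] using this

/-- Duhamel estimate for the difference of two inner flows. -/
lemma norm_conjFlow_sub_conjFlow_le {h k : A} (hk : IsSelfAdjoint k) (a : A)
    {t C : ℝ} (ht : 0 ≤ t)
    (hC : ∀ s ∈ Set.Icc 0 t,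
      ‖(k - h) * conjFlow h s a - conjFlow h s a * (k - h)‖ ≤ C) :
    ‖conjFlow k t a - conjFlow h t a‖ ≤ C * t := by
  -- Interpolation between the two flows: forward with `h`, back with `k`. In the derivative only
  -- the difference `k - h` survives.
  have e1 : ∀ s : ℝ, HasDerivAt (fun s : ℝ => conjFlow k (-s) (conjFlow h s a))
      (conjFlow k (-s) (-(Complex.I • ((k - h) * conjFlow h s a - conjFlow h s a * (k - h))))) s := by
    intro s
    have f1 : HasDerivAt (fun s : ℝ => NormedSpace.exp ((Complex.I * (-s : ℝ)) • k))
        (NormedSpace.exp ((Complex.I * (-s : ℝ)) • k) * (-(Complex.I • k))) s := by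
      have := hasDerivAt_exp_smul_const (𝕂 := ℝ) (-(Complex.I • k)) s
      simpa [mul_comm Complex.I, mul_smul] using this
    have f2 : HasDerivAt (fun s : ℝ => NormedSpace.exp ((-(Complex.I * (-s : ℝ))) • k))
        ((Complex.I • k) * NormedSpace.exp ((-(Complex.I * (-s : ℝ))) • k)) s := by
      have := hasDerivAt_exp_smul_const' (𝕂 := ℝ) (Complex.I • k) s
      simpa [mul_comm Complex.I, mul_smul] using this
    have f3 := hasDerivAt_conjFlow h a s
    convert! (f1.mul f3).mul f2 using 1
    have f4 : conjFlow h s (Complex.I • (h * a - a * h)) =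
        Complex.I • (h * conjFlow h s a - conjFlow h s a * h) := by
      rw [conjFlow_map_smul, conjFlow_commutator, conjFlow_self]
    rw [f4]
    simp only [Pi.mul_apply]
    generalize conjFlow h s a = c
    simp only [conjFlow, smul_sub, mul_sub, sub_mul, mul_assoc, smul_mul_assoc,
      mul_smul_comm, neg_mul, mul_neg, add_mul]
    abel
  have e2 := norm_image_sub_le_of_norm_deriv_le_segment'
    (f := fun s : ℝ => conjFlow k (-s) (conjFlow h s a)) (a := 0) (b := t) (C := C)
    (fun s _ => (e1 s).hasDerivWithinAt)
    (fun s hs => by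
      rw [norm_conjFlow hk, norm_neg, norm_smul, Complex.norm_I, one_mul]
      exact hC s ⟨hs.1, hs.2.le⟩) t ⟨ht, le_rfl⟩
  have e3 : conjFlow k t a - conjFlow h t a =
      -conjFlow k t (conjFlow k (-t) (conjFlow h t a) - conjFlow k (-0) (conjFlow h 0 a)) := by
    rw [conjFlow_map_sub, ← conjFlow_add, add_neg_cancel, neg_zero, conjFlow_zero, conjFlow_zero,
      conjFlow_zero]
    abel
  rw [e3, norm_neg, norm_conjFlow hk]
  simpa using e2

lemma map_conjFlow {B : Type*} [CStarAlgebra B] (f : A →⋆ₐ[ℂ] B) (h a : A) (t : ℝ) :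
    f (conjFlow h t a) = conjFlow (f h) t (f a) := by
  let _ : NormedAlgebra ℚ A := .restrictScalars ℚ ℂ A
  let _ : NormedAlgebra ℚ B := .restrictScalars ℚ ℂ B
  have hf : Continuous f := AddMonoidHomClass.continuous_of_bound f 1 fun x => by
    simpa using NonUnitalStarAlgHom.norm_apply_le f x
  simp only [conjFlow, map_mul, NormedSpace.map_exp f hf, map_smul]

end ConjFlow

end SpinLattice

end

noncomputable section

namespace SpinLattice

/-! ### A Grönwall estimate for families -/

/-- By `hstep`, a bound with constant S controls the derivative by `c S e^{2cs} g`. Integration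
turns S into `M + S/2`, the factor 1/2 coming from the rate 2c in place of c. Iterating this
contraction from the crude bound `S₀` leads to its fixed point 2M. -/
lemma norm_le_of_family_deriv_le {κ V : Type*} [NormedAddCommGroup V] [NormedSpace ℝ V]
    {f f' : κ → ℝ → V} {g : κ → ℝ} {c T M S₀ : ℝ} (hc : 0 ≤ c) (hM : 0 ≤ M) (hS₀ : 0 ≤ S₀)
    (hg : ∀ k, 0 ≤ g k) (hf : ∀ k s, HasDerivAt (f k) (f' k s) s)
    (h0 : ∀ k, ‖f k 0‖ ≤ M * g k)
    (hbdd : ∀ k, ∀ s ∈ Set.Icc 0 T, ‖f k s‖ ≤ S₀ * Real.exp (2 * c * s) * g k)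
    (hstep : ∀ S, 0 ≤ S →
      (∀ k, ∀ s ∈ Set.Icc 0 T, ‖f k s‖ ≤ S * Real.exp (2 * c * s) * g k) →
      ∀ k, ∀ s ∈ Set.Icc 0 T, ‖f' k s‖ ≤ c * S * Real.exp (2 * c * s) * g k) :
    ∀ k, ∀ s ∈ Set.Icc 0 T, ‖f k s‖ ≤ 2 * M * Real.exp (2 * c * s) * g k := by
  have key : ∀ S, 0 ≤ S →
      (∀ k, ∀ s ∈ Set.Icc 0 T, ‖f k s‖ ≤ S * Real.exp (2 * c * s) * g k) →
      ∀ k, ∀ s ∈ Set.Icc 0 T, ‖f k s‖ ≤ (M + S / 2) * Real.exp (2 * c * s) * g k := by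
    intro S hS h k s hs
    have hB : ∀ x : ℝ, HasDerivAt
        (fun x => (M + S / 2 * (Real.exp (2 * c * x) - 1)) * g k)
        (c * S * Real.exp (2 * c * x) * g k) x := by
      intro x
      have h1 : HasDerivAt (fun x : ℝ => Real.exp (2 * c * x)) (Real.exp (2 * c * x) * (2 * c)) x := by
        simpa using ((hasDerivAt_id x).const_mul (2 * c)).exp
      convert! (((h1.sub_const 1).const_mul (S / 2)).const_add M).mul_const (g k) using 1
      ring
    have h2 := image_norm_le_of_norm_deriv_right_le_deriv_boundary (f := f k) (f' := f' k)
      (a := 0) (b := T) (fun x _ => (hf k x).continuousAt.continuousWithinAt)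
      (fun x _ => (hf k x).hasDerivWithinAt) (by simpa using h0 k) hB
      (fun x hx => hstep S hS h k x ⟨hx.1, hx.2.le⟩) hs
    refine h2.trans (mul_le_mul_of_nonneg_right ?_ (hg k))
    have h3 : 1 ≤ Real.exp (2 * c * s) := Real.one_le_exp (by have := hs.1; positivity)
    nlinarith
  have iter : ∀ n : ℕ, ∀ k, ∀ s ∈ Set.Icc 0 T,
      ‖f k s‖ ≤ (2 * M + S₀ * (1 / 2) ^ n) * Real.exp (2 * c * s) * g k := by
    intro n
    induction n with
    | zero =>
      intro k s hs
      refine (hbdd k s hs).trans ?_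
      have := hg k
      gcongr
      linarith
    | succ n ih =>
      intro k s hs
      have := key _ (by positivity) ih k s hs
      convert! this using 3
      ring
  intro k s hs
  have hlim : Tendsto (fun n : ℕ => (2 * M + S₀ * (1 / 2) ^ n) * Real.exp (2 * c * s) * g k) atTop
      (𝓝 ((2 * M + S₀ * 0) * Real.exp (2 * c * s) * g k)) :=
    (((tendsto_pow_atTop_nhds_zero_of_lt_one (by norm_num) (by norm_num)).const_mul S₀
      |>.const_add (2 * M)).mul_const _).mul_const _
  simpa using ge_of_tendsto' hlim fun n => iter n k s hs

/-! ### Commuting systems of matrix units -/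

section Support

variable {𝓗 S ι : Type*} [NormedAddCommGroup 𝓗] [InnerProductSpace ℂ 𝓗]

/-- `B` is supported in `Z`: it commutes with everything that commutes with the matrix units at
the sites of `Z`. -/
def IsSupportedIn (e : S → ι → ι → 𝓗 →L[ℂ] 𝓗) (Z : Finset S) (B : 𝓗 →L[ℂ] 𝓗) : Prop :=
  ∀ C, (∀ z ∈ Z, ∀ i j, Commute C (e z i j)) → Commute C B

namespace IsSupportedIn

variable {e : S → ι → ι → 𝓗 →L[ℂ] 𝓗}

lemma unit {Z : Finset S} {z : S} (hz : z ∈ Z) (i j : ι) :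
    IsSupportedIn e Z (e z i j) :=
  fun _ hC => hC z hz i j

lemma mul {Z : Finset S} {B C : 𝓗 →L[ℂ] 𝓗} (hB : IsSupportedIn e Z B)
    (hC : IsSupportedIn e Z C) : IsSupportedIn e Z (B * C) :=
  fun D hD => (hB D hD).mul_right (hC D hD)

lemma sub {Z : Finset S} {B C : 𝓗 →L[ℂ] 𝓗} (hB : IsSupportedIn e Z B)
    (hC : IsSupportedIn e Z C) : IsSupportedIn e Z (B - C) :=
  fun D hD => (hB D hD).sub_right (hC D hD)

end IsSupportedIn

end Support

section MatrixUnits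

variable {𝓗 S ι : Type*} [NormedAddCommGroup 𝓗] [InnerProductSpace ℂ 𝓗] [CompleteSpace 𝓗]
  [Fintype ι] [DecidableEq ι]

/-- Matrix units at every site, which commute for different sites. -/
structure IsSiteUnits (e : S → ι → ι → 𝓗 →L[ℂ] 𝓗) : Prop where
  mul : ∀ z i j k m, e z i j * e z k m = if j = k then e z i m else 0
  star : ∀ z i j, star (e z i j) = e z j i
  sum : ∀ z, ∑ i, e z i i = 1
  comm : ∀ z w, z ≠ w → ∀ i j k m, Commute (e z i j) (e w k m)

/-- The slice map at the site `z` with respect to the basis vector `o`. -/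
def siteSlice (e : S → ι → ι → 𝓗 →L[ℂ] 𝓗) (o : ι) (z : S) (A : 𝓗 →L[ℂ] 𝓗) : 𝓗 →L[ℂ] 𝓗 :=
  ∑ i, e z i o * A * e z o i

variable {e : S → ι → ι → 𝓗 →L[ℂ] 𝓗}

namespace IsSiteUnits

lemma norm_le_one (he : IsSiteUnits e) (z : S) (i j : ι) : ‖e z i j‖ ≤ 1 := by
  have h1 : ∀ i j, ‖e z i j‖ * ‖e z i j‖ = ‖e z j j‖ := fun i j => by
    rw [← CStarRing.norm_star_mul_self, he.star, he.mul, if_pos rfl]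
  have h2 := h1 j j
  have h3 := h1 i j
  have h4 : ‖e z j j‖ ≤ 1 := by
    by_contra! h
    nlinarith
  by_contra! h
  nlinarith

lemma sum_norm_sq (he : IsSiteUnits e) (o : ι) (z : S) (f : 𝓗) :
    ∑ i, ‖e z o i f‖ ^ 2 = ‖f‖ ^ 2 := by
  have h1 : ∀ i, ((‖e z o i f‖ ^ 2 : ℝ) : ℂ) = ⟪f, e z i i f⟫_ℂ := fun i => by
    have : e z i i = Star.star (e z o i) * e z o i := by rw [he.star, he.mul, if_pos rfl]
    rw [this, ContinuousLinearMap.star_eq_adjoint, mul_apply_eq_comp,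
      ContinuousLinearMap.adjoint_inner_right, inner_self_eq_norm_sq_to_K]
    simp
  have h2 : ((∑ i, ‖e z o i f‖ ^ 2 : ℝ) : ℂ) = ((‖f‖ ^ 2 : ℝ) : ℂ) := by
    rw [Complex.ofReal_sum, Finset.sum_congr rfl fun i _ => h1 i, ← inner_sum,
      ← sum_apply, he.sum, one_apply_eq_self,
      inner_self_eq_norm_sq_to_K]
    simp
  exact_mod_cast h2

/-- In the coordinates `f ↦ (e z o i f)ᵢ`, which preserve the norm by `sum_norm_sq`, the slice acts
diagonally, by the compression `e z o o * A` on every component. -/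
lemma norm_siteSlice_le (he : IsSiteUnits e) (o : ι) (z : S) (A : 𝓗 →L[ℂ] 𝓗) :
    ‖siteSlice e o z A‖ ≤ ‖A‖ := by
  refine ContinuousLinearMap.opNorm_le_bound _ (norm_nonneg _) fun f => ?_
  refine le_of_sq_le_sq ?_ (by positivity)
  have h0 : ∀ i, e z o i (siteSlice e o z A f) = e z o o (A (e z o i f)) := by
    intro i
    have : e z o i * siteSlice e o z A = e z o o * A * e z o i := by
      simp only [siteSlice, Finset.mul_sum, ← mul_assoc, he.mul]
      rw [Finset.sum_eq_single i]
      · simp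
      · intro b _ hb; simp [hb.symm]
      · simp
    simpa using DFunLike.congr_fun this f
  rw [← he.sum_norm_sq o z, mul_pow, ← he.sum_norm_sq o z f, Finset.mul_sum]
  refine Finset.sum_le_sum fun i _ => ?_
  rw [h0, ← mul_pow]
  gcongr
  calc ‖e z o o (A (e z o i f))‖ ≤ 1 * ‖A (e z o i f)‖ :=
        (e z o o).le_of_opNorm_le (he.norm_le_one z o o) _
    _ ≤ _ := by rw [one_mul]; exact A.le_opNorm _

lemma commute_siteSlice (he : IsSiteUnits e) (o : ι) (z : S) (A : 𝓗 →L[ℂ] 𝓗) (k m : ι) :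
    Commute (siteSlice e o z A) (e z k m) := by
  rw [Commute, SemiconjBy, siteSlice, Finset.sum_mul, Finset.mul_sum]
  simp only [mul_assoc, he.mul]
  simp only [← mul_assoc, he.mul, ite_mul, zero_mul, mul_ite, mul_zero]
  simp

lemma commute_siteSlice_of_ne (he : IsSiteUnits e) (o : ι) {z w : S} (hzw : w ≠ z)
    {A : 𝓗 →L[ℂ] 𝓗} {k m : ι} (hA : Commute A (e w k m)) :
    Commute (siteSlice e o z A) (e w k m) := by
  refine Commute.sum_left _ _ _ fun i _ => ?_
  exact ((he.comm z w hzw.symm _ _ _ _).mul_left hA).mul_left (he.comm z w hzw.symm _ _ _ _)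

/-- Inserting `1 = ∑ᵢ e_{io} e_{oi}` writes the difference as `-∑ᵢ e_{io} [A, e_{oi}]`: slicing
costs little if `A` nearly commutes with the site. -/
lemma norm_sub_siteSlice_le (he : IsSiteUnits e) (o : ι) (z : S) (A : 𝓗 →L[ℂ] 𝓗) :
    ‖A - siteSlice e o z A‖ ≤ ∑ i, ‖A * e z o i - e z o i * A‖ := by
  have h1 : A - siteSlice e o z A = ∑ i, e z i o * -(A * e z o i - e z o i * A) := by
    have : A = ∑ i, e z i o * e z o i * A := by
      simp [he.mul, ← Finset.sum_mul, he.sum]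
    rw [siteSlice]
    conv_lhs => rw [this]
    rw [← Finset.sum_sub_distrib]
    refine Finset.sum_congr rfl fun i _ => ?_
    rw [← this]
    noncomm_ring
  rw [h1]
  refine (norm_sum_le _ _).trans (Finset.sum_le_sum fun i _ => ?_)
  refine (norm_mul_le _ _).trans ?_
  rw [norm_neg]
  exact mul_le_of_le_one_left (norm_nonneg _) (he.norm_le_one z i o)

/-- The sites of Z are sliced one after the other. Slices are contractive, so earlier errors do not
grow and each new error involves a commutator of the original `A` only. -/
lemma exists_commute_norm_sub_le (he : IsSiteUnits e) (o : ι) (A : 𝓗 →L[ℂ] 𝓗) (Z : Finset S) :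
    ∃ A' : 𝓗 →L[ℂ] 𝓗, (∀ z ∈ Z, ∀ i j, Commute A' (e z i j)) ∧
      ‖A - A'‖ ≤ ∑ z ∈ Z, ∑ i, ‖A * e z o i - e z o i * A‖ := by
  classical
  induction Z using Finset.induction_on with
  | empty => exact ⟨A, by simp, by simp⟩
  | insert z Z hz ih =>
    obtain ⟨A', h1, h2⟩ := ih
    refine ⟨siteSlice e o z A', fun w hw i j => ?_, ?_⟩
    · by_cases hwz : w = z
      · subst hwz; exact he.commute_siteSlice o w A' i j
      · exact he.commute_siteSlice_of_ne o hwz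
          (h1 w ((Finset.mem_insert.1 hw).resolve_left hwz) i j)
    · rw [Finset.sum_insert hz]
      have h3 : A - siteSlice e o z A' = (A - siteSlice e o z A) + siteSlice e o z (A - A') := by
        simp [siteSlice, mul_sub, sub_mul]
      rw [h3]
      exact (norm_add_le _ _).trans (add_le_add (he.norm_sub_siteSlice_le o z A)
        ((he.norm_siteSlice_le o z _).trans h2))

/-- With `A'` the sliced operator, which commutes with `B`, one has `[A, B] = [A - A', B]`. Thus
single-site commutators control the commutator with every observable supported in Z, which is what
closes the Lieb-Robinson inequalities. -/
lemma norm_commutator_le (he : IsSiteUnits e) (o : ι) (A : 𝓗 →L[ℂ] 𝓗) {Z : Finset S}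
    {B : 𝓗 →L[ℂ] 𝓗} (hB : IsSupportedIn e Z B) :
    ‖A * B - B * A‖ ≤ 2 * ‖B‖ * ∑ z ∈ Z, ∑ i, ‖A * e z o i - e z o i * A‖ := by
  obtain ⟨A', h1, h2⟩ := he.exists_commute_norm_sub_le o A Z
  have h3 : A * B - B * A = (A - A') * B - B * (A - A') := by
    rw [sub_mul, mul_sub, (hB A' h1).eq]; abel
  rw [h3]
  have h4 := norm_sub_le ((A - A') * B) (B * (A - A'))
  have h5 := norm_mul_le (A - A') B
  have h6 := norm_mul_le B (A - A')
  have h7 : ‖B‖ * ‖A - A'‖ ≤ ‖B‖ * ∑ z ∈ Z, ∑ i, ‖A * e z o i - e z o i * A‖ := by gcongr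
  nlinarith

end IsSiteUnits

namespace IsSupportedIn

lemma commute_unit (he : IsSiteUnits e) {Z : Finset S} {B : 𝓗 →L[ℂ] 𝓗} (hB : IsSupportedIn e Z B)
    {z : S} (hz : z ∉ Z) (i j : ι) : Commute (e z i j) B :=
  hB _ fun w hw k m => he.comm z w (fun h => hz (h ▸ hw)) i j k m

end IsSupportedIn

/-! ### Lieb-Robinson bound -/

/-- Only the terms with z ∈ Z fail to commute with a unit at z, and their commutator with it is
again supported in Z, with norm at most `2‖h Z‖`. Then `norm_commutator_le` applies and gives
another 2 and a factor `card ι` from the sum over the units, hence the constant in `hc`. -/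
lemma norm_commutator_commutator_le (he : IsSiteUnits e) (o : ι)
    {h : Finset S → 𝓗 →L[ℂ] 𝓗} {P : Finset (Finset S)} {G : S → ℝ} {c R : ℝ}
    [DecidableEq S] (hloc : ∀ Z ∈ P, IsSupportedIn e Z (h Z)) (hR : 0 ≤ R)
    {z : S}
    (hc : 4 * Fintype.card ι * ∑ Z ∈ P with z ∈ Z, ‖h Z‖ * ∑ w ∈ Z, G w ≤ c * G z)
    {A : 𝓗 →L[ℂ] 𝓗}
    (hA : ∀ Z ∈ P, ∀ w ∈ Z, ∀ i, ‖A * e w o i - e w o i * A‖ ≤ R * G w) (i : ι) :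
    ‖A * ((∑ Z ∈ P, h Z) * e z o i - e z o i * ∑ Z ∈ P, h Z) -
      ((∑ Z ∈ P, h Z) * e z o i - e z o i * ∑ Z ∈ P, h Z) * A‖ ≤ R * (c * G z) := by
  have h1 : (∑ Z ∈ P, h Z) * e z o i - e z o i * ∑ Z ∈ P, h Z =
      ∑ Z ∈ P with z ∈ Z, (h Z * e z o i - e z o i * h Z) := by
    rw [Finset.sum_mul, Finset.mul_sum, ← Finset.sum_sub_distrib, Finset.sum_filter]
    refine Finset.sum_congr rfl fun Z hZ => ?_
    split_ifs with hk
    · rfl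
    · rw [((hloc Z hZ).commute_unit he hk o i).eq, sub_self]
  rw [h1, Finset.mul_sum, Finset.sum_mul, ← Finset.sum_sub_distrib]
  have h5 : ∀ Z ∈ P, z ∈ Z →
      ‖A * (h Z * e z o i - e z o i * h Z) - (h Z * e z o i - e z o i * h Z) * A‖ ≤
      R * (4 * Fintype.card ι) * (‖h Z‖ * ∑ w ∈ Z, G w) := by
    intro Z hZ hk
    have hu := IsSupportedIn.unit (e := e) hk o i
    refine (he.norm_commutator_le o A (((hloc Z hZ).mul hu).sub (hu.mul (hloc Z hZ)))).trans ?_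
    have h6 : ‖h Z * e z o i - e z o i * h Z‖ ≤ 2 * ‖h Z‖ := by
      have h2 := norm_sub_le (h Z * e z o i) (e z o i * h Z)
      have h3 := norm_mul_le (h Z) (e z o i)
      have h4 := norm_mul_le (e z o i) (h Z)
      have h5 := he.norm_le_one z o i
      nlinarith [norm_nonneg (h Z)]
    have h7 : ∑ w ∈ Z, ∑ j, ‖A * e w o j - e w o j * A‖ ≤
        ∑ w ∈ Z, Fintype.card ι * (R * G w) :=
      Finset.sum_le_sum fun w hw =>
        (Finset.sum_le_card_nsmul _ _ (R * G w) fun j _ => hA Z hZ w hw j).trans_eq (by simp)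
    refine (mul_le_mul (mul_le_mul_of_nonneg_left h6 zero_le_two) h7 (by positivity)
      (by positivity)).trans_eq ?_
    rw [← Finset.mul_sum, ← Finset.mul_sum]; ring
  refine (norm_sum_le _ _).trans ((Finset.sum_le_sum fun Z hZ =>
    h5 Z (Finset.mem_filter.1 hZ).1 (Finset.mem_filter.1 hZ).2).trans ?_)
  rw [← Finset.mul_sum, mul_assoc]
  exact mul_le_mul_of_nonneg_left hc hR

/-- Lieb-Robinson bound: commutators of an evolved observable with the matrix units stay bounded
by a weight that is adapted to the interaction. -/
theorem norm_conjFlow_commutator_unit_le (he : IsSiteUnits e) (o : ι)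
    {h : Finset S → 𝓗 →L[ℂ] 𝓗} {P : Finset (Finset S)} {W : Finset S} {G : S → ℝ} {c M : ℝ}
    [DecidableEq S]
    (hsa : ∀ Z ∈ P, IsSelfAdjoint (h Z)) (hloc : ∀ Z ∈ P, IsSupportedIn e Z (h Z))
    (hPW : ∀ Z ∈ P, Z ⊆ W) (hG : ∀ z, 0 < G z) (hc0 : 0 ≤ c) (hM : 0 ≤ M)
    (hc : ∀ z ∈ W, 4 * Fintype.card ι * ∑ Z ∈ P with z ∈ Z, ‖h Z‖ * ∑ w ∈ Z, G w ≤ c * G z)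
    {A : 𝓗 →L[ℂ] 𝓗} (hA : ∀ z ∈ W, ∀ i, ‖A * e z o i - e z o i * A‖ ≤ M * G z)
    {t : ℝ} (ht : 0 ≤ t) {z : S} (hz : z ∈ W) (i : ι) :
    ‖conjFlow (∑ Z ∈ P, h Z) t A * e z o i - e z o i * conjFlow (∑ Z ∈ P, h Z) t A‖ ≤
      2 * M * Real.exp (2 * c * t) * G z := by
  set H : 𝓗 →L[ℂ] 𝓗 := ∑ Z ∈ P, h Z with hH
  have hHsa : IsSelfAdjoint H := by
    rw [hH, IsSelfAdjoint, star_sum]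
    exact Finset.sum_congr rfl fun Z hZ => hsa Z hZ
  -- the commutators, transported back in time
  have hback : ∀ (s : ℝ) (u : 𝓗 →L[ℂ] 𝓗),
      ‖A * conjFlow (-H) s u - conjFlow (-H) s u * A‖ =
        ‖conjFlow H s A * u - u * conjFlow H s A‖ := by
    intro s u
    rw [← norm_conjFlow hHsa (-s) (conjFlow H s A * u - u * conjFlow H s A),
      conjFlow_commutator, conjFlow_neg_conjFlow, conjFlow_neg_left]
  -- With the flow moved onto the unit, the time derivative produces `[H, e z o i]`, which involves
  -- only interaction terms that contain z.
  let f : W × ι → ℝ → 𝓗 →L[ℂ] 𝓗 := fun k s =>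
    A * conjFlow (-H) s (e k.1 o k.2) - conjFlow (-H) s (e k.1 o k.2) * A
  let f' : W × ι → ℝ → 𝓗 →L[ℂ] 𝓗 := fun k s =>
    A * conjFlow (-H) s (Complex.I • (-H * e k.1 o k.2 - e k.1 o k.2 * -H)) -
      conjFlow (-H) s (Complex.I • (-H * e k.1 o k.2 - e k.1 o k.2 * -H)) * A
  have hf : ∀ k s, HasDerivAt (f k) (f' k s) s := fun k s => by
    have h1 := hasDerivAt_conjFlow (-H) (e k.1 o k.2) s
    exact (h1.const_mul A).sub (h1.mul_const A)
  -- The starting bound `S₀` is crude: commutators are at most `2‖A‖`, and on the finite set W this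
  -- is a multiple of the positive weight G. It does not enter the final constant.
  have key := norm_le_of_family_deriv_le (f := f) (f' := f') (g := fun k => G k.1) (c := c)
    (T := t) (M := M) (S₀ := ∑ w ∈ W, 2 * ‖A‖ / G w) hc0 hM
    (Finset.sum_nonneg fun w _ => div_nonneg (by positivity) (hG w).le)
    (fun k => (hG _).le) hf
    (fun k => by simpa [f, conjFlow_zero] using hA k.1 k.1.2 k.2)
    (fun k s hs => by
      have h1 : ‖f k s‖ ≤ 2 * ‖A‖ := by
        have h2 := norm_sub_le (conjFlow H s A * e k.1 o k.2) (e k.1 o k.2 * conjFlow H s A)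
        have h3 := norm_mul_le (conjFlow H s A) (e k.1 o k.2)
        have h4 := norm_mul_le (e k.1 o k.2) (conjFlow H s A)
        have h5 := he.norm_le_one k.1 o k.2
        rw [norm_conjFlow hHsa] at h3 h4
        have : ‖f k s‖ = _ := hback s (e k.1 o k.2)
        rw [this]
        nlinarith [norm_nonneg A]
      have h2 : 2 * ‖A‖ / G k.1 ≤ ∑ w ∈ W, 2 * ‖A‖ / G w :=
        Finset.single_le_sum (f := fun w => 2 * ‖A‖ / G w)
          (fun w _ => div_nonneg (by positivity) (hG w).le) k.1.2
      have h3 : 1 ≤ Real.exp (2 * c * s) := Real.one_le_exp (by have := hs.1; positivity)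
      rw [div_le_iff₀ (hG _)] at h2
      have h4 : 0 ≤ (∑ w ∈ W, 2 * ‖A‖ / G w) * G k.1 := le_trans (by positivity) h2
      nlinarith)
    (fun R hR hb k s hs => by
      have h2 : ‖f' k s‖ = ‖conjFlow H s A * (H * e k.1 o k.2 - e k.1 o k.2 * H) -
          (H * e k.1 o k.2 - e k.1 o k.2 * H) * conjFlow H s A‖ := by
        have h3 : Complex.I • (-H * e k.1 o k.2 - e k.1 o k.2 * -H) =
            (-Complex.I) • (H * e k.1 o k.2 - e k.1 o k.2 * H) := by
          rw [neg_smul, ← smul_neg]; congr 1; noncomm_ring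
        have h4 : ‖f' k s‖ = _ := hback s (Complex.I • (-H * e k.1 o k.2 - e k.1 o k.2 * -H))
        rw [h4, h3, mul_smul_comm, smul_mul_assoc, ← smul_sub, norm_smul, norm_neg,
          Complex.norm_I, one_mul]
      rw [h2]
      refine (norm_commutator_commutator_le he o hloc
        (show 0 ≤ R * Real.exp (2 * c * s) by positivity) (hc k.1 k.1.2)
        (fun Z hZ w hw j => ?_) k.2).trans_eq (by ring)
      rw [← hback]
      exact hb (⟨w, hPW Z hZ hw⟩, j) s hs)
    (⟨z, hz⟩, i) t ⟨ht, le_rfl⟩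
  have hfin : ‖f (⟨z, hz⟩, i) t‖ = _ := hback t (e z o i)
  rw [hfin] at key
  exact key

/-- The effect on the flow of enlarging the set of interaction terms. -/
theorem norm_conjFlow_sub_conjFlow_le_of_subset (he : IsSiteUnits e) (o : ι)
    {h : Finset S → 𝓗 →L[ℂ] 𝓗} {P Q : Finset (Finset S)} {W : Finset S} {G : S → ℝ} {c M : ℝ}
    [DecidableEq S] (hPQ : P ⊆ Q)
    (hsa : ∀ Z ∈ Q, IsSelfAdjoint (h Z)) (hloc : ∀ Z ∈ Q, IsSupportedIn e Z (h Z))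
    (hQW : ∀ Z ∈ Q, Z ⊆ W) (hG : ∀ z, 0 < G z) (hc0 : 0 ≤ c) (hM : 0 ≤ M)
    (hc : ∀ z ∈ W, 4 * Fintype.card ι * ∑ Z ∈ P with z ∈ Z, ‖h Z‖ * ∑ w ∈ Z, G w ≤ c * G z)
    {A : 𝓗 →L[ℂ] 𝓗} (hA : ∀ z ∈ W, ∀ i, ‖A * e z o i - e z o i * A‖ ≤ M * G z)
    {t : ℝ} (ht : 0 ≤ t) :
    ‖conjFlow (∑ Z ∈ Q, h Z) t A - conjFlow (∑ Z ∈ P, h Z) t A‖ ≤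
      4 * Fintype.card ι * M * Real.exp (2 * c * t) * t *
        ∑ Z ∈ Q \ P, ‖h Z‖ * ∑ w ∈ Z, G w := by
  have hsum : ∀ {R : Finset (Finset S)}, R ⊆ Q → IsSelfAdjoint (∑ Z ∈ R, h Z) := fun hR => by
    rw [IsSelfAdjoint, star_sum]
    exact Finset.sum_congr rfl fun Z hZ => hsa Z (hR hZ)
  have hdiff : ∑ Z ∈ Q, h Z - ∑ Z ∈ P, h Z = ∑ Z ∈ Q \ P, h Z := by
    rw [← Finset.sum_sdiff hPQ, add_sub_cancel_right]
  -- Duhamel with the P-flow acting first: the Lieb-Robinson bound is needed for P only, but at all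
  -- sites of W, since the terms of `Q \ P` may reach anywhere in W.
  refine (norm_conjFlow_sub_conjFlow_le (C := 4 * Fintype.card ι * M * Real.exp (2 * c * t) *
    ∑ Z ∈ Q \ P, ‖h Z‖ * ∑ w ∈ Z, G w) (hsum subset_rfl) A ht fun s hs => ?_).trans_eq (by ring)
  rw [hdiff, Finset.sum_mul, Finset.mul_sum, ← Finset.sum_sub_distrib, Finset.mul_sum]
  refine (norm_sum_le _ _).trans (Finset.sum_le_sum fun Z hZ => ?_)
  have hZQ := (Finset.mem_sdiff.1 hZ).1
  rw [← norm_neg, neg_sub]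
  refine (he.norm_commutator_le o _ (hloc Z hZQ)).trans ?_
  have h7 : ∑ w ∈ Z, ∑ j, ‖conjFlow (∑ Z ∈ P, h Z) s A * e w o j -
      e w o j * conjFlow (∑ Z ∈ P, h Z) s A‖ ≤
      ∑ w ∈ Z, Fintype.card ι * (2 * M * Real.exp (2 * c * t) * G w) := by
    refine Finset.sum_le_sum fun w hw =>
      (Finset.sum_le_card_nsmul _ _ (2 * M * Real.exp (2 * c * t) * G w) fun j _ => ?_).trans_eq
        (by simp)
    refine (norm_conjFlow_commutator_unit_le he o (fun Z hZ => hsa Z (hPQ hZ))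
      (fun Z hZ => hloc Z (hPQ hZ)) (fun Z hZ => hQW Z (hPQ hZ)) hG hc0 hM hc hA hs.1
      (hQW Z hZQ hw) j).trans ?_
    have := (hG w).le
    gcongr
    exact hs.2
  refine (mul_le_mul_of_nonneg_left h7 (by positivity)).trans_eq ?_
  rw [← Finset.mul_sum, ← Finset.mul_sum]; ring

end MatrixUnits

end SpinLattice

end

noncomputable section

namespace SpinLattice

/-! ### The matrix units at the sites of the lattice -/

section SiteUnit

variable {d ℓ : ℕ}

/-- The matrix unit of `𝔄(Z)` given by the restrictions to `Z` of two configurations. -/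
def configUnit (Z : Finset (Site d)) (s t : Config d ℓ) : ConfigSpace d ℓ →L[ℂ] ConfigSpace d ℓ :=
  localRep ℓ Z (Matrix.single (restrictConfig Z s) (restrictConfig Z t) 1)

/-- The matrix unit `|i⟩⟨j|` at the site `z`. -/
def siteUnit (z : Site d) (i j : Fin ℓ) : ConfigSpace d ℓ →L[ℂ] ConfigSpace d ℓ :=
  configUnit {z} (fun _ => i) (fun _ => j)

lemma restrictConfig_eq_iff {Z : Finset (Site d)} {s t : Config d ℓ} :
    restrictConfig Z s = restrictConfig Z t ↔ ∀ x ∈ Z, s x = t x := by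
  simp [funext_iff, restrictConfig]

lemma glue_restrictConfig' (Z : Finset (Site d)) (s t : Config d ℓ) :
    glue Z s (restrictConfig Z t) = Z.piecewise t s := by
  funext x; by_cases h : x ∈ Z <;> simp [glue, restrictConfig, h]

lemma configUnit_apply (Z : Finset (Site d)) (s t : Config d ℓ) (f : ConfigSpace d ℓ)
    (σ : Config d ℓ) :
    configUnit Z s t f σ = if ∀ x ∈ Z, s x = σ x then f (Z.piecewise t σ) else 0 := by
  have : configUnit Z s t f σ = ∑ r, Matrix.single (restrictConfig Z s) (restrictConfig Z t) (1 : ℂ)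
      (restrictConfig Z σ) r * f (glue Z σ r) := rfl
  rw [this, ← glue_restrictConfig', Finset.sum_eq_single (restrictConfig Z t)]
  · simp only [Matrix.single_apply, restrictConfig_eq_iff, and_true, ite_mul, one_mul, zero_mul]
  · intro b _ hb
    simp [hb.symm]
  · simp

/-- Matrix units of a region factor over its sites. Iterated, this reduces support in Z to
commutation with single-site units. -/
lemma configUnit_insert {Z : Finset (Site d)} {z : Site d} (hz : z ∉ Z) (s t : Config d ℓ) :
    configUnit (insert z Z) s t = configUnit Z s t * siteUnit z (s z) (t z) := by
  ext f σ
  rw [mul_apply_eq_comp, configUnit_apply, configUnit_apply, siteUnit, configUnit_apply]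
  have h1 : (Z.piecewise t σ) z = σ z := by simp [hz]
  have h2 : (insert z Z).piecewise t σ = ({z} : Finset _).piecewise (fun _ => t z)
      (Z.piecewise t σ) := by
    funext x
    by_cases hx : x = z
    · subst hx; simp
    · simp [Finset.piecewise, hx]
  simp only [Finset.mem_insert, forall_eq_or_imp, Finset.mem_singleton, forall_eq, h1, h2]
  by_cases ha : s z = σ z <;> simp [ha]

lemma isSiteUnits_siteUnit : IsSiteUnits (siteUnit (d := d) (ℓ := ℓ)) where
  mul z i j k m := by
    simp only [siteUnit, configUnit, ← map_mul]
    have hjk : restrictConfig {z} (fun _ : Site d => j) = restrictConfig {z} (fun _ => k) ↔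
        j = k := by simp [restrictConfig_eq_iff]
    by_cases h : j = k
    · subst h; simp
    · rw [if_neg h, Matrix.single_mul_single_of_ne (h := mt hjk.1 h), map_zero]
  star z i j := by
    simp only [siteUnit, configUnit, ← map_star]
    simp [Matrix.star_eq_conjTranspose]
  sum z := by
    simp only [siteUnit, configUnit, ← map_sum]
    convert! map_one (localRep ℓ ({z} : Finset (Site d)))
    ext r r'
    have hr : ∀ (i : Fin ℓ) (r : LocalConfig ℓ ({z} : Finset (Site d))),
        restrictConfig {z} (fun _ : Site d => i) = r ↔ i = r ⟨z, by simp⟩ := by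
      intro i r
      constructor
      · rintro rfl; rfl
      · rintro rfl
        funext ⟨x, hx⟩
        obtain rfl := Finset.mem_singleton.1 hx
        rfl
    have hr2 : r = r' ↔ r ⟨z, by simp⟩ = r' ⟨z, by simp⟩ :=
      ⟨fun h => h ▸ rfl, fun h => ((hr _ r).2 rfl).symm.trans ((hr _ r').2 h)⟩
    simp only [Matrix.sum_apply, Matrix.single_apply, hr, Matrix.one_apply, hr2]
    by_cases h : r ⟨z, by simp⟩ = r' ⟨z, by simp⟩
    · simp [h]
    · rw [if_neg h]
      refine Finset.sum_eq_zero fun i _ => if_neg ?_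
      rintro ⟨rfl, h'⟩
      exact h h'
  comm z w hzw i j k m := by
    ext f σ
    simp only [mul_apply_eq_comp, siteUnit, configUnit_apply]
    have h2 : ({w} : Finset (Site d)).piecewise (fun _ => m)
        (({z} : Finset (Site d)).piecewise (fun _ => j) σ) =
        ({z} : Finset (Site d)).piecewise (fun _ => j)
          (({w} : Finset (Site d)).piecewise (fun _ => m) σ) := by
      funext x
      by_cases hx : x = z
      · subst hx; simp [hzw]
      · simp [Finset.piecewise, hx]
    simp only [Finset.mem_singleton, forall_eq, h2]
    simp [hzw, hzw.symm]
    split_ifs <;> rfl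

lemma isSupportedIn_configUnit (Z : Finset (Site d)) (s t : Config d ℓ) :
    IsSupportedIn siteUnit Z (configUnit Z s t) := by
  intro C hC
  induction Z using Finset.induction_on with
  | empty =>
    have : configUnit (∅ : Finset (Site d)) s t = 1 := by
      ext f σ; simp [configUnit_apply]
    rw [this]; exact Commute.one_right C
  | insert z Z hz ih =>
    rw [configUnit_insert hz]
    exact (ih fun w hw => hC w (Finset.mem_insert_of_mem hw)).mul_right
      (hC z (Finset.mem_insert_self z Z) _ _)

lemma restrictConfig_surjective [NeZero ℓ] (Z : Finset (Site d)) :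
    Function.Surjective (restrictConfig (ℓ := ℓ) Z) := fun s =>
  ⟨glue Z (fun _ => 0) s, restrictConfig_glue Z _ s⟩

lemma isSupportedIn_localRep [NeZero ℓ] (Z : Finset (Site d)) (B : LocalAlg ℓ Z) :
    IsSupportedIn siteUnit Z (localRep ℓ Z B) := by
  intro C hC
  rw [Matrix.matrix_eq_sum_single B, map_sum]
  refine Commute.sum_right _ _ _ fun r _ => ?_
  rw [map_sum]
  refine Commute.sum_right _ _ _ fun r' _ => ?_
  obtain ⟨s, rfl⟩ := restrictConfig_surjective Z r
  obtain ⟨t, rfl⟩ := restrictConfig_surjective Z r'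
  have : Matrix.single (restrictConfig Z s) (restrictConfig Z t)
      (B (restrictConfig Z s) (restrictConfig Z t)) =
      B (restrictConfig Z s) (restrictConfig Z t) •
        Matrix.single (restrictConfig Z s) (restrictConfig Z t) (1 : ℂ) := by simp
  rw [this, map_smul]
  exact (isSupportedIn_configUnit Z s t C hC).smul_right _

/-- In the sum over configurations of Λ only those that agree with σ off X contribute, and they are
indexed by the configurations of X. Hence the local algebras act compatibly. -/
lemma localRep_extendMatrix {X Λ : Finset (Site d)} (h : X ⊆ Λ) (A : LocalAlg ℓ X) :
    localRep ℓ Λ (extendMatrix h A) = localRep ℓ X A := by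
  ext f σ
  change ∑ s, extendMatrix h A (restrictConfig Λ σ) s * f (glue Λ σ s) =
    ∑ s, A (restrictConfig X σ) s * f (glue X σ s)
  have hinj : Function.Injective fun s : LocalConfig ℓ X => restrictConfig Λ (glue X σ s) := by
    intro s t hst
    funext x
    have := congrFun hst ⟨x.1, h x.2⟩
    simpa [restrictConfig, glue] using this
  refine (Finset.sum_of_injOn (fun s : LocalConfig ℓ X => restrictConfig Λ (glue X σ s))
    hinj.injOn (by simp) ?_ ?_).symm
  · intro s _ hs
    have : ¬ ∀ x : Λ, x.1 ∉ X → restrictConfig Λ σ x = s x := by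
      intro hx
      refine hs ⟨fun x => s ⟨x.1, h x.2⟩, by simp, ?_⟩
      funext x
      by_cases hxX : x.1 ∈ X
      · simp [restrictConfig, glue, hxX]
      · simpa [restrictConfig, glue, hxX] using hx x hxX
    rw [extendMatrix, Matrix.of_apply, if_neg this, zero_mul]
  · intro s _
    have h1 : ∀ x : Λ, x.1 ∉ X → restrictConfig Λ σ x = restrictConfig Λ (glue X σ s) x := by
      intro x hx
      simp [restrictConfig, glue, hx]
    have h2 : glue Λ σ (restrictConfig Λ (glue X σ s)) = glue X σ s := by
      funext x
      by_cases hx : x ∈ Λ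
      · simp [glue, restrictConfig, hx]
      · have : x ∉ X := fun h' => hx (h h')
        simp [glue, hx, this]
    have h3 : (fun x : X => restrictConfig Λ (glue X σ s) ⟨x.1, h x.2⟩) = s := by
      funext x; simp [restrictConfig, glue]
    simp only [extendMatrix, Matrix.of_apply, if_pos h1, h2, h3]
    rfl

lemma localRep_injective [NeZero ℓ] (Z : Finset (Site d)) :
    Function.Injective (localRep ℓ Z) := by
  classical
  rw [injective_iff_map_eq_zero]
  intro B hB
  ext r s
  obtain ⟨σ, rfl⟩ := restrictConfig_surjective Z r
  -- Applied to the basis vector at the configuration `glue Z σ s`, the operator has at σ the value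
  -- `B r s`.
  have h1 := congrArg (fun T : ConfigSpace d ℓ →L[ℂ] ConfigSpace d ℓ =>
    T (lp.single 2 (glue Z σ s) (1 : ℂ)) σ) hB
  change ∑ t, B (restrictConfig Z σ) t * (lp.single 2 (glue Z σ s) (1 : ℂ) : ConfigSpace d ℓ)
    (glue Z σ t) = 0 at h1
  rw [Finset.sum_eq_single s] at h1
  · simpa using h1
  · intro t _ ht
    have : glue Z σ t ≠ glue Z σ s := fun h => ht (by
      rw [← restrictConfig_glue Z σ t, h, restrictConfig_glue])
    simp [this]
  · simp

open scoped Matrix.Norms.L2Operator in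
-- An injective star homomorphism between C⋆-algebras is isometric.
lemma norm_localRep [NeZero ℓ] (Z : Finset (Site d)) (B : LocalAlg ℓ Z) :
    ‖localRep ℓ Z B‖ = ‖B‖ :=
  NonUnitalStarAlgHom.norm_map (localRep ℓ Z) (localRep_injective Z) B

open scoped Matrix.Norms.L2Operator in
lemma norm_localRep_translateMatrix [NeZero ℓ] (a : Site d) (Z : Finset (Site d))
    (B : LocalAlg ℓ Z) :
    ‖localRep ℓ (Z.map (addRightEmbedding a)) (translateMatrix a B)‖ = ‖localRep ℓ Z B‖ := by
  let g : Z ≃ (Z.map (addRightEmbedding a) : Finset (Site d)) :=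
    { toFun := fun x => ⟨x.1 + a, Finset.mem_map_of_mem (addRightEmbedding a) x.2⟩
      invFun := fun y => ⟨y.1 - a, by
        obtain ⟨x, hx, hxy⟩ := Finset.mem_map.1 y.2
        rw [← hxy]; simpa using hx⟩
      left_inv := fun x => by simp
      right_inv := fun y => by simp }
  let e : LocalConfig ℓ Z ≃ LocalConfig ℓ (Z.map (addRightEmbedding a)) := g.arrowCongr (.refl _)
  rw [norm_localRep, norm_localRep]
  have h1 : translateMatrix a B = Matrix.reindexAlgEquiv ℂ ℂ e B := rfl
  let T : LocalAlg ℓ Z →⋆ₐ[ℂ] LocalAlg ℓ (Z.map (addRightEmbedding a)) :=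
    { (Matrix.reindexAlgEquiv ℂ ℂ e : _ →ₐ[ℂ] _) with
      map_star' := fun B => rfl }
  rw [h1]
  exact NonUnitalStarAlgHom.norm_map T (Matrix.reindexAlgEquiv ℂ ℂ e).injective B

end SiteUnit

end SpinLattice

end

noncomputable section

namespace SpinLattice

/-! ### Decay of the interaction -/

section Decay

variable {d ℓ : ℕ} {N : AddGroupNorm (Site d)} {F : ℝ → ℝ}

lemma sum_biUnion_le {α β : Type*} [DecidableEq β] (s : Finset α) (t : α → Finset β) (f : β → ℝ)
    (hf : ∀ b, 0 ≤ f b) : ∑ b ∈ s.biUnion t, f b ≤ ∑ a ∈ s, ∑ b ∈ t a, f b := by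
  classical
  induction s using Finset.induction_on with
  | empty => simp
  | insert a s ha ih =>
    rw [Finset.biUnion_insert, Finset.sum_insert ha]
    have h1 := Finset.sum_union_inter (s₁ := t a) (s₂ := s.biUnion t) (f := f)
    have h2 : 0 ≤ ∑ b ∈ t a ∩ s.biUnion t, f b := Finset.sum_nonneg fun b _ => hf b
    linarith

/-- The pair bound `∑_{Z ∋ x, y} ‖h(Z)‖ ≤ C F(|x - y|)`. -/
def HasPairDecay (N : AddGroupNorm (Site d)) (F : ℝ → ℝ) (C : ℝ)
    (h : Finset (Site d) → ConfigSpace d ℓ →L[ℂ] ConfigSpace d ℓ) : Prop :=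
  ∀ (x y : Site d) (P : Finset (Finset (Site d))),
    ∑ Z ∈ P with x ∈ Z ∧ y ∈ Z, ‖h Z‖ ≤ C * F (N (x - y))

lemma IsDecayFunction.pos_norm (hF : IsDecayFunction N F) (x : Site d) : 0 < F (N x) :=
  hF.pos _ (apply_nonneg N x)

/-- The decay norm controls the pairs (x, 0), and translating by -y brings (x, y) to (x - y, 0). The
factor `e^{-λ|x|} ≤ 1` is discarded, as F alone suffices for the rest. -/
lemma Interaction.exists_hasPairDecay [NeZero ℓ] (hF : IsDecayFunction N F) {lam : ℝ}
    (hlam : 0 < lam) {Φ : Interaction d ℓ} (hΦ : Φ.TranslationInvariant)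
    (hΦF : Φ.decayNorm N F lam < ⊤) :
    ∃ C, 0 ≤ C ∧ HasPairDecay N F C fun Z => localRep ℓ Z (Φ.term Z) := by
  have h1 : ∀ (x : Site d) (P : Finset (Finset (Site d))), (∀ Z ∈ P, x ∈ Z ∧ 0 ∈ Z) →
      ∑ Z ∈ P, ‖localRep ℓ Z (Φ.term Z)‖ ≤ (Φ.decayNorm N F lam).toReal * F (N x) := by
    intro x P hP
    have hpos : 0 < Real.exp (-lam * N x) * F (N x) := mul_pos (Real.exp_pos _) (hF.pos_norm x)
    have h2 : ENNReal.ofReal (∑ Z ∈ P, ‖localRep ℓ Z (Φ.term Z)‖ /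
        (Real.exp (-lam * N x) * F (N x))) ≤ Φ.decayNorm N F lam := by
      rw [ENNReal.ofReal_sum_of_nonneg fun _ _ => by positivity]
      refine le_trans ?_ (le_iSup _ x)
      rw [← Finset.sum_subtype_of_mem (p := fun Z : Finset (Site d) => x ∈ Z ∧ 0 ∈ Z)
        (fun Z => ENNReal.ofReal (‖localRep ℓ Z (Φ.term Z)‖ /
          (Real.exp (-lam * N x) * F (N x)))) hP]
      exact ENNReal.sum_le_tsum (f := fun Z : {X : Finset (Site d) // x ∈ X ∧ 0 ∈ X} =>
        ENNReal.ofReal (‖localObs Z.1 (Φ.term Z.1)‖ / (Real.exp (-lam * N x) * F (N x)))) _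
    rw [ENNReal.ofReal_le_iff_le_toReal hΦF.ne, ← Finset.sum_div, div_le_iff₀ hpos] at h2
    refine h2.trans (mul_le_mul_of_nonneg_left ?_ ENNReal.toReal_nonneg)
    refine mul_le_of_le_one_left (hF.pos_norm x).le (Real.exp_le_one_iff.2 ?_)
    have := apply_nonneg N x
    nlinarith
  refine ⟨(Φ.decayNorm N F lam).toReal, ENNReal.toReal_nonneg, fun x y P => ?_⟩
  have h3 := h1 (x - y) ((P.filter fun Z => x ∈ Z ∧ y ∈ Z).map
    (Finset.mapEmbedding (addRightEmbedding (-y))).toEmbedding) (by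
      intro Z hZ
      obtain ⟨Z', hZ', rfl⟩ := Finset.mem_map.1 hZ
      have := (Finset.mem_filter.1 hZ').2
      refine ⟨Finset.mem_map.2 ⟨x, this.1, ?_⟩, Finset.mem_map.2 ⟨y, this.2, ?_⟩⟩
      · simp [sub_eq_add_neg]
      · simp)
  rw [Finset.sum_map] at h3
  refine le_trans (Finset.sum_le_sum fun Z _ => le_of_eq ?_) h3
  change _ = ‖localRep ℓ (Z.map (addRightEmbedding (-y))) (Φ.term (Z.map (addRightEmbedding (-y))))‖
  rw [hΦ, norm_localRep_translateMatrix]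

/-- The weight `∑_{x ∈ X ∪ {0}} F(|z - x|)` attached to the region `X`. -/
def regionWeight (N : AddGroupNorm (Site d)) (F : ℝ → ℝ) (X : Finset (Site d)) (z : Site d) : ℝ :=
  ∑ x ∈ insert 0 X, F (N (z - x))

/-- The extra site 0 keeps the weight positive when X is empty. -/
lemma regionWeight_pos (hF : IsDecayFunction N F) (X : Finset (Site d)) (z : Site d) :
    0 < regionWeight N F X z :=
  Finset.sum_pos (fun _ _ => hF.pos_norm _) (Finset.insert_nonempty 0 X)

lemma summable_regionWeight (hF : IsDecayFunction N F) (X : Finset (Site d)) :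
    Summable (regionWeight N F X) :=
  summable_sum fun x _ => (Equiv.subRight x).summable_iff.2 hF.summable

lemma le_regionWeight (hF : IsDecayFunction N F) {X : Finset (Site d)} {z : Site d} (hz : z ∈ X) :
    F 0 ≤ regionWeight N F X z := by
  have := Finset.single_le_sum (f := fun x => F (N (z - x))) (s := insert 0 X)
    (fun _ _ => (hF.pos_norm _).le) (Finset.mem_insert_of_mem hz)
  simpa [regionWeight] using this

/-- The convolution condition on F, applied to each summand of the weight: convolving with F
reproduces the weight up to a constant. -/
lemma exists_sum_mul_regionWeight_le (hF : IsDecayFunction N F) :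
    ∃ C, 0 ≤ C ∧ ∀ (X W : Finset (Site d)) (z : Site d),
      ∑ w ∈ W, F (N (z - w)) * regionWeight N F X w ≤ C * regionWeight N F X z := by
  obtain ⟨C, hC⟩ := hF.convolution
  have h0 : ∀ x y : Site d, ∀ z, 0 ≤ F (N (z - x)) * F (N (y - z)) / F (N (y - x)) :=
    fun x y z => div_nonneg (mul_nonneg (hF.pos_norm _).le (hF.pos_norm _).le) (hF.pos_norm _).le
  refine ⟨C, (tsum_nonneg (h0 0 0)).trans (hC 0 0).2, fun X W z => ?_⟩
  simp only [regionWeight, Finset.mul_sum]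
  rw [Finset.sum_comm]
  refine Finset.sum_le_sum fun x _ => ?_
  have h1 := ((hC x z).1.sum_le_tsum W fun w _ => h0 x z w).trans (hC x z).2
  rw [← Finset.sum_div, div_le_iff₀ (hF.pos_norm _)] at h1
  exact (Finset.sum_le_sum fun w _ => (mul_comm _ _).le).trans h1

variable {h : Finset (Site d) → ConfigSpace d ℓ →L[ℂ] ConfigSpace d ℓ} {C : ℝ}

lemma HasPairDecay.neg (hh : HasPairDecay N F C h) : HasPairDecay N F C (-h) := by
  simpa [HasPairDecay] using hh

/-- Summing over w first, `∑_{Z ∋ z, w} ‖h Z‖ ≤ C F(|z - w|)` leaves a convolution of F with the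
weight. Up to a factor 4ℓ this is the condition on the weight in the Lieb-Robinson bound. -/
lemma HasPairDecay.exists_sum_le (hh : HasPairDecay N F C h) (hC : 0 ≤ C)
    (hF : IsDecayFunction N F) :
    ∃ D, 0 ≤ D ∧ ∀ (X : Finset (Site d)) (P : Finset (Finset (Site d))) (z : Site d),
      ∑ Z ∈ P with z ∈ Z, ‖h Z‖ * ∑ w ∈ Z, regionWeight N F X w ≤ D * regionWeight N F X z := by
  obtain ⟨D, hD0, hD⟩ := exists_sum_mul_regionWeight_le hF
  refine ⟨C * D, by positivity, fun X P z => ?_⟩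
  have h1 : ∑ Z ∈ P with z ∈ Z, ‖h Z‖ * ∑ w ∈ Z, regionWeight N F X w =
      ∑ w ∈ P.biUnion id, (∑ Z ∈ P with z ∈ Z ∧ w ∈ Z, ‖h Z‖) * regionWeight N F X w := by
    simp only [Finset.mul_sum, Finset.sum_mul]
    rw [Finset.sum_comm' (t' := P.biUnion id) (s' := fun w => P.filter fun Z => z ∈ Z ∧ w ∈ Z)]
    intro Z w
    simp only [Finset.mem_filter, Finset.mem_biUnion, id]
    constructor
    · rintro ⟨⟨h1, h2⟩, h3⟩; exact ⟨⟨h1, h2, h3⟩, Z, h1, h3⟩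
    · rintro ⟨⟨h1, h2, h3⟩, _⟩; exact ⟨⟨h1, h2⟩, h3⟩
  rw [h1]
  calc _ ≤ ∑ w ∈ P.biUnion id, C * (F (N (z - w)) * regionWeight N F X w) := by
        refine Finset.sum_le_sum fun w _ => ?_
        rw [← mul_assoc]
        exact mul_le_mul_of_nonneg_right (hh z w P) (regionWeight_pos hF X w).le
    _ ≤ C * (D * regionWeight N F X z) := by
        rw [← Finset.mul_sum]
        exact mul_le_mul_of_nonneg_left (hD X _ z) hC
    _ = _ := by ring

lemma norm_mul_sub_mul_le {R : Type*} [NormedRing R] (a b : R) :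
    ‖a * b - b * a‖ ≤ 2 * ‖a‖ * ‖b‖ := by
  have h1 := norm_sub_le (a * b) (b * a)
  have h2 := norm_mul_le a b
  have h3 := norm_mul_le b a
  linarith

/-- The initial data of the Lieb-Robinson bound: the commutator vanishes off X, and on X the weight
is at least `F 0`. -/
lemma norm_commutator_siteUnit_le (hF : IsDecayFunction N F) {X : Finset (Site d)}
    {A : ConfigSpace d ℓ →L[ℂ] ConfigSpace d ℓ} (hA : IsSupportedIn siteUnit X A)
    (z : Site d) (i j : Fin ℓ) :
    ‖A * siteUnit z i j - siteUnit z i j * A‖ ≤ 2 * ‖A‖ / F 0 * regionWeight N F X z := by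
  have hF0 := hF.pos 0 le_rfl
  by_cases hz : z ∈ X
  · calc _ ≤ 2 * ‖A‖ * ‖siteUnit z i j‖ := norm_mul_sub_mul_le _ _
      _ ≤ 2 * ‖A‖ * 1 := by gcongr; exact isSiteUnits_siteUnit.norm_le_one z i j
      _ = 2 * ‖A‖ / F 0 * F 0 := by field_simp
      _ ≤ _ := by gcongr; exact le_regionWeight hF hz
  · rw [(hA.commute_unit isSiteUnits_siteUnit hz i j).eq, sub_self, norm_zero]
    have := (regionWeight_pos hF X z).le
    positivity

/-- Existence of the thermodynamic limit of the dynamics of a local observable. -/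
theorem HasPairDecay.cauchySeq_conjFlow_of_nonneg [NeZero ℓ] (hh : HasPairDecay N F C h)
    (hC : 0 ≤ C) (hF : IsDecayFunction N F) (hsa : ∀ Z, IsSelfAdjoint (h Z))
    (hloc : ∀ Z, IsSupportedIn siteUnit Z (h Z)) {X : Finset (Site d)}
    {A : ConfigSpace d ℓ →L[ℂ] ConfigSpace d ℓ} (hA : IsSupportedIn siteUnit X A) {t : ℝ}
    (ht : 0 ≤ t) :
    CauchySeq fun Λ : Finset (Site d) => conjFlow (∑ Z ∈ Λ.powerset, h Z) t A := by
  obtain ⟨D, hD0, hD⟩ := hh.exists_sum_le hC hF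
  have hF0 := hF.pos 0 le_rfl
  set c : ℝ := 4 * ℓ * D
  set K : ℝ := 4 * ℓ * (2 * ‖A‖ / F 0) * Real.exp (2 * c * t) * t with hK
  have hK0 : 0 ≤ K := by positivity
  have key : ∀ Λ Λ' : Finset (Site d), Λ ⊆ Λ' →
      ‖conjFlow (∑ Z ∈ Λ'.powerset, h Z) t A - conjFlow (∑ Z ∈ Λ.powerset, h Z) t A‖ ≤
        K * (D * ∑ y ∈ Λ' \ Λ, regionWeight N F X y) := by
    intro Λ Λ' hΛ
    have h1 := norm_conjFlow_sub_conjFlow_le_of_subset (isSiteUnits_siteUnit (d := d) (ℓ := ℓ)) 0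
      (h := h) (W := Λ') (G := regionWeight N F X) (c := c) (M := 2 * ‖A‖ / F 0) (A := A)
      (Finset.powerset_mono.2 hΛ)
      (fun Z _ => hsa Z) (fun Z _ => hloc Z) (fun Z hZ => Finset.mem_powerset.1 hZ)
      (regionWeight_pos hF X) (by positivity) (by positivity)
      (fun z _ => by
        rw [Fintype.card_fin, mul_assoc (4 * (ℓ : ℝ)) D]
        exact mul_le_mul_of_nonneg_left (hD X _ z) (by positivity))
      (fun z _ i => norm_commutator_siteUnit_le hF hA z 0 i) ht
    rw [Fintype.card_fin] at h1
    refine h1.trans (mul_le_mul_of_nonneg_left ?_ hK0)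
    have h2 : ∀ Z, 0 ≤ ‖h Z‖ * ∑ w ∈ Z, regionWeight N F X w := fun Z =>
      mul_nonneg (norm_nonneg _) (Finset.sum_nonneg fun w _ => (regionWeight_pos hF X w).le)
    -- A term inside Λ' but not inside Λ contains some y ∈ Λ' \ Λ, so a union bound over y applies.
    calc _ ≤ ∑ Z ∈ (Λ' \ Λ).biUnion fun y => Λ'.powerset.filter fun Z => y ∈ Z,
          ‖h Z‖ * ∑ w ∈ Z, regionWeight N F X w := by
          refine Finset.sum_le_sum_of_subset_of_nonneg (fun Z hZ => ?_) fun Z _ _ => h2 Z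
          obtain ⟨hZ1, hZ2⟩ := Finset.mem_sdiff.1 hZ
          obtain ⟨y, hy, hyΛ⟩ := Finset.not_subset.1 (mt Finset.mem_powerset.2 hZ2)
          exact Finset.mem_biUnion.2 ⟨y, Finset.mem_sdiff.2
            ⟨Finset.mem_powerset.1 hZ1 hy, hyΛ⟩, Finset.mem_filter.2 ⟨hZ1, hy⟩⟩
      _ ≤ ∑ y ∈ Λ' \ Λ, ∑ Z ∈ Λ'.powerset with y ∈ Z,
          ‖h Z‖ * ∑ w ∈ Z, regionWeight N F X w := sum_biUnion_le _ _ _ h2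
      _ ≤ ∑ y ∈ Λ' \ Λ, D * regionWeight N F X y := Finset.sum_le_sum fun y _ => hD X _ y
      _ = _ := (Finset.mul_sum _ _ _).symm
  rw [Metric.cauchySeq_iff']
  intro ε hε
  -- Outside a large Λ the weight sums to less than `ε / (K D + 1)`; the 1 covers the case `K D =
  -- 0`.
  obtain ⟨Λ, hΛ⟩ := summable_iff_vanishing_norm.1 (summable_regionWeight hF X)
    (ε / (K * D + 1)) (by positivity)
  refine ⟨Λ, fun Λ' hΛ' => ?_⟩
  rw [dist_eq_norm]
  refine (key Λ Λ' hΛ').trans_lt ?_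
  have h3 := (le_abs_self _).trans_lt (hΛ (Λ' \ Λ) Finset.sdiff_disjoint)
  rw [lt_div_iff₀ (by positivity)] at h3
  have h4 : 0 ≤ ∑ y ∈ Λ' \ Λ, regionWeight N F X y :=
    Finset.sum_nonneg fun w _ => (regionWeight_pos hF X w).le
  nlinarith

theorem HasPairDecay.cauchySeq_conjFlow [NeZero ℓ] (hh : HasPairDecay N F C h)
    (hC : 0 ≤ C) (hF : IsDecayFunction N F) (hsa : ∀ Z, IsSelfAdjoint (h Z))
    (hloc : ∀ Z, IsSupportedIn siteUnit Z (h Z)) {X : Finset (Site d)}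
    {A : ConfigSpace d ℓ →L[ℂ] ConfigSpace d ℓ} (hA : IsSupportedIn siteUnit X A) (t : ℝ) :
    CauchySeq fun Λ : Finset (Site d) => conjFlow (∑ Z ∈ Λ.powerset, h Z) t A := by
  rcases le_total 0 t with ht | ht
  · exact hh.cauchySeq_conjFlow_of_nonneg hC hF hsa hloc hA ht
  · have h1 := hh.neg.cauchySeq_conjFlow_of_nonneg hC hF (fun Z => (hsa Z).neg)
      (fun Z D hD => (hloc Z D hD).neg_right) hA (neg_nonneg.2 ht)
    convert h1 using 2 with Λ
    simp [← conjFlow_neg_left]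

/-- Local observables have uniformly bounded commutators with the local Hamiltonians. -/
lemma HasPairDecay.exists_norm_commutator_le [NeZero ℓ] (hh : HasPairDecay N F C h)
    (hloc : ∀ Z, IsSupportedIn siteUnit Z (h Z)) {X : Finset (Site d)}
    {A : ConfigSpace d ℓ →L[ℂ] ConfigSpace d ℓ} (hA : IsSupportedIn siteUnit X A) :
    ∃ K, ∀ Λ : Finset (Site d),
      ‖(∑ Z ∈ Λ.powerset, h Z) * A - A * ∑ Z ∈ Λ.powerset, h Z‖ ≤ K := by
  refine ⟨∑ x ∈ X, 2 * ‖A‖ * (C * F (N (x - x))), fun Λ => ?_⟩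
  rw [Finset.sum_mul, Finset.mul_sum, ← Finset.sum_sub_distrib]
  have h1 : ∀ Z, (∀ x ∈ X, x ∉ Z) → h Z * A - A * h Z = 0 := fun Z hZ => by
    rw [sub_eq_zero]
    exact hA _ fun x hx i j => ((hloc Z).commute_unit isSiteUnits_siteUnit (hZ x hx) i j).symm
  calc _ ≤ ∑ Z ∈ Λ.powerset, ‖h Z * A - A * h Z‖ := norm_sum_le _ _
    _ = ∑ Z ∈ X.biUnion fun x => Λ.powerset.filter fun Z => x ∈ Z, ‖h Z * A - A * h Z‖ := by
        refine (Finset.sum_subset (fun Z hZ => ?_) fun Z hZ hZ' => ?_).symm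
        · obtain ⟨x, _, hx⟩ := Finset.mem_biUnion.1 hZ
          exact (Finset.mem_filter.1 hx).1
        · rw [h1 Z, norm_zero]
          exact fun x hx hxZ => hZ' (Finset.mem_biUnion.2 ⟨x, hx, Finset.mem_filter.2 ⟨hZ, hxZ⟩⟩)
    _ ≤ ∑ x ∈ X, ∑ Z ∈ Λ.powerset with x ∈ Z, ‖h Z * A - A * h Z‖ :=
        sum_biUnion_le _ _ _ fun _ => norm_nonneg _
    _ ≤ _ := by
        refine Finset.sum_le_sum fun x _ => ?_
        refine le_trans (Finset.sum_le_sum fun Z _ =>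
          (norm_mul_sub_mul_le (h Z) A).trans_eq (by ring : _ = 2 * ‖A‖ * ‖h Z‖)) ?_
        rw [← Finset.mul_sum]
        refine mul_le_mul_of_nonneg_left ?_ (by positivity)
        simpa using hh x x Λ.powerset

end Decay

end SpinLattice

end

noncomputable section

namespace SpinLattice

/-! ### States are contractive -/

/-- Positivity at `a + z 1` with z = 1 and z = i gives `φ(a⋆) = conj φ(a)`, and z = -φ(a) gives
`|φ(a)|² ≤ φ(a⋆ a)`. The order bound `a⋆ a ≤ ‖a‖² 1` finishes. -/
lemma norm_apply_le_of_state {A : Type*} [CStarAlgebra A] {φ : A →ₗ[ℂ] ℂ} (h1 : φ 1 = 1)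
    (hpos : ∀ a, 0 ≤ φ (star a * a)) (a : A) : ‖φ a‖ ≤ ‖a‖ := by
  let _ : PartialOrder A := CStarAlgebra.spectralOrder A
  have _ : StarOrderedRing A := CStarAlgebra.spectralOrderedRing A
  have hsq : (φ (star a * a)).re ≤ ‖a‖ ^ 2 := by
    obtain ⟨c, hc⟩ := CStarAlgebra.nonneg_iff_eq_star_mul_self.1
      (sub_nonneg.2 (CStarAlgebra.star_mul_le_algebraMap_norm_sq (a := a)))
    have h2 := (Complex.le_def.1 (hpos c)).1
    rw [← hc, map_sub, Algebra.algebraMap_eq_smul_one, ← Complex.coe_smul, map_smul, h1] at h2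
    simp only [Complex.zero_re, Complex.sub_re, smul_eq_mul, mul_one, Complex.ofReal_re] at h2
    linarith
  have hexp : ∀ z : ℂ, 0 ≤ φ (star a * a) + z * φ (star a) + star z * φ a + star z * z := by
    intro z
    have h2 := hpos (a + z • 1)
    have h3 : star (a + z • 1) * (a + z • 1) =
        star a * a + z • star a + star z • a + (star z * z) • (1 : A) := by
      simp only [star_add, star_smul, star_one, add_mul, mul_add, mul_smul_comm, mul_one,
        smul_mul_assoc, one_mul, smul_add, smul_smul]
      rw [mul_comm z]
      abel
    rw [h3] at h2
    simpa [h1] using h2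
  have him := (Complex.le_def.1 (hpos a)).2
  have e1 := (Complex.le_def.1 (hexp 1)).2
  have e2 := (Complex.le_def.1 (hexp Complex.I)).2
  have e3 := (Complex.le_def.1 (hexp (-φ a))).1
  simp at him e1 e2 e3
  have hre : (φ (star a)).re = (φ a).re := by linarith
  have him' : (φ (star a)).im = -(φ a).im := by linarith
  rw [hre, him'] at e3
  have h4 : ‖φ a‖ ^ 2 ≤ ‖a‖ ^ 2 := by
    rw [Complex.sq_norm, Complex.normSq_apply]
    nlinarith
  exact le_of_sq_le_sq h4 (norm_nonneg _)

/-! ### The quasilocal algebra as a C⋆-algebra -/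

section QuasiLocal

variable {d ℓ : ℕ}

lemma isClosed_quasiLocalSubalgebra :
    IsClosed (quasiLocalSubalgebra d ℓ : Set (ConfigSpace d ℓ →L[ℂ] ConfigSpace d ℓ)) :=
  StarSubalgebra.isClosed_topologicalClosure _

attribute [local instance] isClosed_quasiLocalSubalgebra

lemma coe_conjFlow (h : QuasiLocalAlgebra d ℓ) (t : ℝ) (a : QuasiLocalAlgebra d ℓ) :
    ((conjFlow h t a : QuasiLocalAlgebra d ℓ) : ConfigSpace d ℓ →L[ℂ] ConfigSpace d ℓ) =
      conjFlow (h : ConfigSpace d ℓ →L[ℂ] ConfigSpace d ℓ) t a :=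
  map_conjFlow (quasiLocalSubalgebra d ℓ).subtype h a t

lemma Interaction.localDynamics_eq (Φ : Interaction d ℓ) (Λ : Finset (Site d)) (t : ℝ)
    (A : QuasiLocalAlgebra d ℓ) :
    Φ.localDynamics Λ t A = conjFlow (localObs Λ (Φ.hamiltonian Λ)) t A := rfl

/-- The inclusion `𝔄(Λ) → 𝔄` as a star homomorphism. -/
def localObsHom (ℓ : ℕ) (Λ : Finset (Site d)) : LocalAlg ℓ Λ →⋆ₐ[ℂ] QuasiLocalAlgebra d ℓ where
  toFun := localObs Λ
  map_one' := Subtype.ext (map_one (localRep ℓ Λ))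
  map_mul' A B := Subtype.ext (map_mul (localRep ℓ Λ) A B)
  map_zero' := Subtype.ext (map_zero (localRep ℓ Λ))
  map_add' A B := Subtype.ext (map_add (localRep ℓ Λ) A B)
  commutes' c := Subtype.ext ((localRep ℓ Λ).commutes c)
  map_star' A := Subtype.ext (map_star (localRep ℓ Λ) A)

lemma localObs_extendMatrix {X Λ : Finset (Site d)} (h : X ⊆ Λ) (A : LocalAlg ℓ X) :
    localObs Λ (extendMatrix h A) = localObs X A :=
  Subtype.ext (localRep_extendMatrix h A)

/-- The local algebras are directed under inclusion, so the star subalgebra they generate is their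
union. -/
lemma dense_localObs :
    Dense {A : QuasiLocalAlgebra d ℓ | ∃ (Λ : Finset (Site d)) (B : LocalAlg ℓ Λ),
      localObs Λ B = A} := by
  have hdir : Directed (· ≤ ·) fun Λ : Finset (Site d) => (localRep ℓ Λ).range := by
    have hmono : ∀ {X Λ : Finset (Site d)}, X ⊆ Λ → (localRep ℓ X).range ≤ (localRep ℓ Λ).range := by
      rintro X Λ h _ ⟨A, rfl⟩
      exact ⟨extendMatrix h A, localRep_extendMatrix h A⟩
    exact fun X Y => ⟨X ∪ Y, hmono Finset.subset_union_left, hmono Finset.subset_union_right⟩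
  rintro ⟨A, hA⟩
  rw [closure_subtype]
  have hA' : A ∈ closure
      ((⨆ Λ : Finset (Site d), (localRep ℓ Λ).range : StarSubalgebra ℂ _) : Set _) := by
    rw [← StarSubalgebra.topologicalClosure_coe]; exact hA
  rw [StarSubalgebra.coe_iSup_of_directed hdir] at hA'
  refine closure_mono ?_ hA'
  intro B hB
  obtain ⟨Λ, B', rfl⟩ := Set.mem_iUnion.1 hB
  exact ⟨localObs Λ B', ⟨Λ, B', rfl⟩, rfl⟩

lemma isSelfAdjoint_localRep_term (Φ : Interaction d ℓ) (Z : Finset (Site d)) :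
    IsSelfAdjoint (localRep ℓ Z (Φ.term Z)) :=
  (show IsSelfAdjoint (Φ.term Z) from Φ.isHermitian_term Z).map (localRep ℓ Z)

lemma localRep_hamiltonian (Φ : Interaction d ℓ) (Λ : Finset (Site d)) :
    localRep ℓ Λ (Φ.hamiltonian Λ) = ∑ Z ∈ Λ.powerset, localRep ℓ Z (Φ.term Z) := by
  rw [Interaction.hamiltonian, map_sum,
    ← Finset.sum_attach Λ.powerset fun Z => localRep ℓ Z (Φ.term Z)]
  exact Finset.sum_congr rfl fun Z _ => localRep_extendMatrix _ _

lemma isSelfAdjoint_localObs_hamiltonian (Φ : Interaction d ℓ) (Λ : Finset (Site d)) :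
    IsSelfAdjoint (localObs Λ (Φ.hamiltonian Λ)) := by
  have : IsSelfAdjoint (localRep ℓ Λ (Φ.hamiltonian Λ)) := by
    rw [localRep_hamiltonian, IsSelfAdjoint, star_sum]
    exact Finset.sum_congr rfl fun Z _ => isSelfAdjoint_localRep_term Φ Z
  exact Subtype.ext this

lemma isHermitian_hamiltonian [NeZero ℓ] (Φ : Interaction d ℓ) (Λ : Finset (Site d)) :
    (Φ.hamiltonian Λ).IsHermitian := by
  apply localRep_injective Λ
  have h1 := congrArg Subtype.val (isSelfAdjoint_localObs_hamiltonian Φ Λ)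
  exact (map_star (localRep ℓ Λ) (Φ.hamiltonian Λ)).trans h1

end QuasiLocal

/-! ### The global dynamics -/

section GlobalDynamics

attribute [local instance] isClosed_quasiLocalSubalgebra

variable {d ℓ : ℕ} {N : AddGroupNorm (Site d)} {F : ℝ → ℝ} {Φ : Interaction d ℓ} {C : ℝ}

/-- Local observables are covered by the Lieb-Robinson estimate. All local flows are isometric, so
an ε/3 argument passes to the norm closure. -/
theorem Interaction.exists_isGlobalDynamics [NeZero ℓ] (hF : IsDecayFunction N F) (hC : 0 ≤ C)
    (hΦ : HasPairDecay N F C fun Z => localRep ℓ Z (Φ.term Z)) :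
    ∃ τ, Φ.IsGlobalDynamics τ := by
  have hloc : ∀ (t : ℝ) (X : Finset (Site d)) (B : LocalAlg ℓ X),
      CauchySeq fun Λ => Φ.localDynamics Λ t (localObs X B) := by
    intro t X B
    have h1 := hΦ.cauchySeq_conjFlow hC hF (isSelfAdjoint_localRep_term Φ)
      (fun Z => isSupportedIn_localRep Z _) (isSupportedIn_localRep X B) t
    rw [Metric.cauchySeq_iff'] at h1 ⊢
    intro ε hε
    obtain ⟨Λ, hΛ⟩ := h1 ε hε
    refine ⟨Λ, fun Λ' hΛ' => ?_⟩
    have h2 := hΛ Λ' hΛ'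
    rw [← localRep_hamiltonian, ← localRep_hamiltonian] at h2
    rw [Subtype.dist_eq, Φ.localDynamics_eq, Φ.localDynamics_eq, coe_conjFlow, coe_conjFlow]
    exact h2
  have hall : ∀ (t : ℝ) (A : QuasiLocalAlgebra d ℓ),
      CauchySeq fun Λ => Φ.localDynamics Λ t A := by
    intro t A
    rw [Metric.cauchySeq_iff']
    intro ε hε
    obtain ⟨_, hB, X, B, rfl⟩ := Metric.dense_iff.1 dense_localObs A (ε / 3) (by positivity)
    obtain ⟨Λ, hΛ⟩ := Metric.cauchySeq_iff'.1 (hloc t X B) (ε / 3) (by positivity)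
    have h3 : ∀ Λ', dist (Φ.localDynamics Λ' t A) (Φ.localDynamics Λ' t (localObs X B)) < ε / 3 := by
      intro Λ'
      rw [dist_eq_norm, Φ.localDynamics_eq, Φ.localDynamics_eq, ← conjFlow_map_sub,
        norm_conjFlow (isSelfAdjoint_localObs_hamiltonian Φ Λ'), ← dist_eq_norm, dist_comm]
      exact hB
    refine ⟨Λ, fun Λ' hΛ' => ?_⟩
    calc _ ≤ _ := dist_triangle4 _ (Φ.localDynamics Λ' t (localObs X B))
          (Φ.localDynamics Λ t (localObs X B)) _
      _ < ε / 3 + ε / 3 + ε / 3 := by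
          refine add_lt_add (add_lt_add (h3 Λ') (hΛ Λ' hΛ')) ?_
          rw [dist_comm]; exact h3 Λ
      _ = ε := by ring
  choose τ hτ using fun (t : ℝ) (A : QuasiLocalAlgebra d ℓ) =>
    cauchySeq_tendsto_of_complete (hall t A)
  exact ⟨τ, hτ⟩

namespace Interaction.IsGlobalDynamics

variable {τ : ℝ → QuasiLocalAlgebra d ℓ → QuasiLocalAlgebra d ℓ}

lemma unique {τ' : ℝ → QuasiLocalAlgebra d ℓ → QuasiLocalAlgebra d ℓ}
    (hτ : Φ.IsGlobalDynamics τ) (hτ' : Φ.IsGlobalDynamics τ') : τ = τ' :=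
  funext fun t => funext fun A => tendsto_nhds_unique (hτ t A) (hτ' t A)

lemma norm_map (hτ : Φ.IsGlobalDynamics τ) (t : ℝ) (A : QuasiLocalAlgebra d ℓ) :
    ‖τ t A‖ = ‖A‖ :=
  tendsto_nhds_unique (hτ t A).norm (by
    simp [Φ.localDynamics_eq, norm_conjFlow (isSelfAdjoint_localObs_hamiltonian Φ _)])

lemma map_add (hτ : Φ.IsGlobalDynamics τ) (t : ℝ) (A B : QuasiLocalAlgebra d ℓ) :
    τ t (A + B) = τ t A + τ t B :=
  tendsto_nhds_unique (hτ t _) (by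
    simpa only [Φ.localDynamics_eq, conjFlow_map_add] using (hτ t A).add (hτ t B))

lemma map_sub (hτ : Φ.IsGlobalDynamics τ) (t : ℝ) (A B : QuasiLocalAlgebra d ℓ) :
    τ t (A - B) = τ t A - τ t B :=
  tendsto_nhds_unique (hτ t _) (by
    simpa only [Φ.localDynamics_eq, conjFlow_map_sub] using (hτ t A).sub (hτ t B))

lemma map_mul (hτ : Φ.IsGlobalDynamics τ) (t : ℝ) (A B : QuasiLocalAlgebra d ℓ) :
    τ t (A * B) = τ t A * τ t B :=
  tendsto_nhds_unique (hτ t _) (by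
    simpa only [Φ.localDynamics_eq, conjFlow_map_mul] using (hτ t A).mul (hτ t B))

lemma map_smul (hτ : Φ.IsGlobalDynamics τ) (t : ℝ) (c : ℂ) (A : QuasiLocalAlgebra d ℓ) :
    τ t (c • A) = c • τ t A :=
  tendsto_nhds_unique (hτ t _) (by
    simpa only [Φ.localDynamics_eq, conjFlow_map_smul] using (hτ t A).const_smul c)

lemma map_one (hτ : Φ.IsGlobalDynamics τ) (t : ℝ) : τ t 1 = 1 :=
  tendsto_nhds_unique (hτ t _) (by
    simpa only [Φ.localDynamics_eq, conjFlow_map_one] using tendsto_const_nhds)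

lemma map_star (hτ : Φ.IsGlobalDynamics τ) (t : ℝ) (A : QuasiLocalAlgebra d ℓ) :
    τ t (star A) = star (τ t A) :=
  tendsto_nhds_unique (hτ t _) (by
    simpa only [Φ.localDynamics_eq, conjFlow_map_star (isSelfAdjoint_localObs_hamiltonian Φ _)]
      using (hτ t A).star)

lemma zero_time (hτ : Φ.IsGlobalDynamics τ) (A : QuasiLocalAlgebra d ℓ) : τ 0 A = A :=
  tendsto_nhds_unique (hτ 0 _) (by
    simpa only [Φ.localDynamics_eq, conjFlow_zero] using tendsto_const_nhds)

/-- The outer finite-volume flow is isometric, so the inner approximant may be replaced by its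
limit. -/
lemma add_time (hτ : Φ.IsGlobalDynamics τ) (s t : ℝ) (A : QuasiLocalAlgebra d ℓ) :
    τ (s + t) A = τ s (τ t A) := by
  refine tendsto_nhds_unique (hτ (s + t) A) ?_
  have h1 : Tendsto (fun Λ => Φ.localDynamics Λ s (Φ.localDynamics Λ t A) -
      Φ.localDynamics Λ s (τ t A)) atTop (𝓝 0) := by
    rw [tendsto_zero_iff_norm_tendsto_zero]
    have h2 := ((hτ t A).sub_const (τ t A)).norm
    rw [sub_self, norm_zero] at h2
    refine h2.congr fun Λ => ?_
    rw [Φ.localDynamics_eq Λ s, Φ.localDynamics_eq Λ s, ← conjFlow_map_sub,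
      norm_conjFlow (isSelfAdjoint_localObs_hamiltonian Φ Λ)]
  have h3 := h1.add (hτ s (τ t A))
  rw [zero_add] at h3
  refine h3.congr fun Λ => ?_
  rw [sub_add_cancel, Φ.localDynamics_eq, Φ.localDynamics_eq, Φ.localDynamics_eq, conjFlow_add]

/-- For local B the commutators with `H_Λ` are bounded uniformly in Λ, so `‖τ_t(B) - B‖ ≤ K|t|`.
Density gives continuity at 0 for every A, and the group law moves it to other times. -/
lemma continuous [NeZero ℓ] (hτ : Φ.IsGlobalDynamics τ)
    (hΦ : HasPairDecay N F C fun Z => localRep ℓ Z (Φ.term Z)) (A : QuasiLocalAlgebra d ℓ) :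
    Continuous fun t => τ t A := by
  have hloc : ∀ (X : Finset (Site d)) (B : LocalAlg ℓ X),
      ContinuousAt (fun t => τ t (localObs X B)) 0 := by
    intro X B
    obtain ⟨K, hK⟩ := hΦ.exists_norm_commutator_le (fun Z => isSupportedIn_localRep Z _)
      (isSupportedIn_localRep X B)
    have h1 : ∀ t, ‖τ t (localObs X B) - localObs X B‖ ≤ K * |t| := by
      intro t
      refine le_of_tendsto ((hτ t (localObs X B)).sub_const _).norm (Eventually.of_forall fun Λ => ?_)
      rw [Φ.localDynamics_eq]
      refine (norm_conjFlow_sub_self_le (isSelfAdjoint_localObs_hamiltonian Φ Λ) _ t).trans ?_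
      refine mul_le_mul_of_nonneg_right ?_ (abs_nonneg t)
      have h2 := hK Λ
      rw [← localRep_hamiltonian] at h2
      exact h2
    rw [ContinuousAt, zero_time hτ, tendsto_iff_norm_sub_tendsto_zero]
    refine squeeze_zero (fun _ => norm_nonneg _) h1 ?_
    have : Continuous fun t : ℝ => K * |t| := by fun_prop
    simpa using this.tendsto 0
  have hall : ∀ A : QuasiLocalAlgebra d ℓ, ContinuousAt (fun t => τ t A) 0 := by
    intro A
    rw [Metric.continuousAt_iff]
    intro ε hε
    obtain ⟨_, hB, X, B, rfl⟩ := Metric.dense_iff.1 dense_localObs A (ε / 3) (by positivity)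
    obtain ⟨δ, hδ, h1⟩ := Metric.continuousAt_iff.1 (hloc X B) (ε / 3) (by positivity)
    refine ⟨δ, hδ, fun t ht => ?_⟩
    have h3 : ∀ t, dist (τ t A) (τ t (localObs X B)) < ε / 3 := fun t => by
      rw [dist_eq_norm, ← map_sub hτ, norm_map hτ, ← dist_eq_norm, dist_comm]
      exact hB
    calc _ ≤ _ := dist_triangle4 _ (τ t (localObs X B)) (τ 0 (localObs X B)) _
      _ < ε / 3 + ε / 3 + ε / 3 := by
          refine add_lt_add (add_lt_add (h3 t) (h1 ht)) ?_
          rw [dist_comm]; exact h3 0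
      _ = ε := by ring
  refine continuous_iff_continuousAt.2 fun s => ?_
  rw [ContinuousAt, tendsto_iff_norm_sub_tendsto_zero]
  have h1 := hall A
  rw [ContinuousAt, zero_time hτ, tendsto_iff_norm_sub_tendsto_zero] at h1
  have h2 : Tendsto (fun t : ℝ => t - s) (𝓝 s) (𝓝 0) := by
    simpa using (continuous_id.sub continuous_const).tendsto (x := s) (f := fun t : ℝ => t - s)
  refine (h1.comp h2).congr fun t => ?_
  simp only [Function.comp]
  rw [← norm_map hτ s, map_sub hτ, ← add_time hτ]
  simp

end Interaction.IsGlobalDynamics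

end GlobalDynamics

end SpinLattice

end

noncomputable section

namespace SpinLattice

open MeasureTheory

/-! ### Laplace transforms of bounded functions -/

section Laplace

variable {V : Type*} [NormedAddCommGroup V] [NormedSpace ℂ V] {a : ℂ} {f : ℝ → V} {C : ℝ}

lemma integrableOn_exp_smul (ha : a.re < 0) (hf : Continuous f) (hC : ∀ t, ‖f t‖ ≤ C) (c : ℝ) :
    IntegrableOn (fun t : ℝ => Complex.exp (a * t) • f t) (Set.Ioi c) := by
  refine Integrable.mono' ((integrableOn_exp_mul_Ioi ha c).mul_const C)
    (Continuous.aestronglyMeasurable (by fun_prop)) (Eventually.of_forall fun t => ?_)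
  rw [norm_smul, Complex.norm_exp]
  simp only [Complex.re_mul_ofReal]
  exact mul_le_mul_of_nonneg_left (hC t) (Real.exp_pos _).le

lemma norm_integral_exp_smul_le (ha : a.re < 0) (hC : ∀ t, ‖f t‖ ≤ C) :
    ‖∫ t in Set.Ioi (0 : ℝ), Complex.exp (a * t) • f t‖ ≤ (-a.re)⁻¹ * C := by
  refine (norm_integral_le_of_norm_le ((integrableOn_exp_mul_Ioi ha 0).mul_const C)
    (Eventually.of_forall fun t => ?_)).trans_eq ?_
  · rw [norm_smul, Complex.norm_exp]
    simp only [Complex.re_mul_ofReal]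
    exact mul_le_mul_of_nonneg_left (hC t) (Real.exp_pos _).le
  · rw [integral_mul_const, integral_exp_mul_Ioi ha]
    simp [inv_neg, neg_div]

lemma tendsto_exp_smul (ha : a.re < 0) (hC : ∀ t, ‖f t‖ ≤ C) :
    Tendsto (fun t : ℝ => Complex.exp (a * t) • f t) atTop (𝓝 0) := by
  rw [tendsto_zero_iff_norm_tendsto_zero]
  have h1 : Tendsto (fun t : ℝ => Real.exp (a.re * t) * C) atTop (𝓝 (0 * C)) :=
    (Real.tendsto_exp_atBot.comp (tendsto_id.const_mul_atTop_of_neg ha)).mul_const C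
  rw [zero_mul] at h1
  refine squeeze_zero (fun _ => norm_nonneg _) (fun t => ?_) h1
  rw [norm_smul, Complex.norm_exp]
  simp only [Complex.re_mul_ofReal]
  exact mul_le_mul_of_nonneg_left (hC t) (Real.exp_pos _).le

lemma hasDerivAt_exp_mul_ofReal (a : ℂ) (t : ℝ) :
    HasDerivAt (fun t : ℝ => Complex.exp (a * t)) (a * Complex.exp (a * t)) t := by
  have h1 : HasDerivAt (fun t : ℝ => a * (t : ℂ)) (a * 1) t :=
    (Complex.ofRealCLM.hasDerivAt (x := t)).const_mul a
  convert! h1.cexp using 1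
  ring

/-- Integration by parts for the Laplace transform. -/
lemma integral_exp_smul_of_hasDerivAt [CompleteSpace V] (ha : a.re < 0) {f' : ℝ → V}
    (hf : ∀ t, HasDerivAt f (f' t) t) (hf' : Continuous f') {C' : ℝ}
    (hC : ∀ t, ‖f t‖ ≤ C) (hC' : ∀ t, ‖f' t‖ ≤ C') :
    ∫ t in Set.Ioi (0 : ℝ), Complex.exp (a * t) • (a • f t + f' t) = -f 0 := by
  have hfc : Continuous f := continuous_iff_continuousAt.2 fun t => (hf t).continuousAt
  have h1 := integral_Ioi_of_hasDerivAt_of_tendsto' (a := 0) (m := 0)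
    (f := fun t : ℝ => Complex.exp (a * t) • f t)
    (f' := fun t : ℝ => Complex.exp (a * t) • (a • f t + f' t))
    (fun t _ => by
      convert! (hasDerivAt_exp_mul_ofReal a t).smul (hf t) using 1
      rw [smul_add, smul_smul, mul_comm, add_comm])
    (integrableOn_exp_smul ha (C := ‖a‖ * C + C') (by fun_prop) (fun t => by
      refine (norm_add_le _ _).trans (add_le_add ?_ (hC' t))
      rw [norm_smul]
      exact mul_le_mul_of_nonneg_left (hC t) (norm_nonneg a)) 0)
    (tendsto_exp_smul ha hC)
  simpa using h1

end Laplace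

/-! ### Resolvents of generators of unitary groups -/

lemma generator_apply_of_hasDerivAt {K : Type*} [NormedAddCommGroup K] [InnerProductSpace ℂ K]
    {U : ℝ → K →L[ℂ] K} {v w : K} (h : HasDerivAt (fun t => U t v) w 0) :
    ∃ hv : v ∈ (generator U).domain, generator U ⟨v, hv⟩ = (-Complex.I) • w :=
  ⟨h.differentiableAt, congrArg ((-Complex.I) • ·) h.deriv⟩

section UnitaryGroup

variable {K : Type*} [NormedAddCommGroup K] [InnerProductSpace ℂ K] [CompleteSpace K]
  {U : ℝ → K →L[ℂ] K}

lemma IsUnitaryGroup.norm_map (hU : IsUnitaryGroup U) (t : ℝ) (v : K) : ‖U t v‖ = ‖v‖ :=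
  ContinuousLinearMap.norm_map_of_mem_unitary (hU.mem_unitary t) v

lemma IsUnitaryGroup.hasDerivAt (hU : IsUnitaryGroup U) (v : (generator U).domain) (t : ℝ) :
    HasDerivAt (fun t => U t (v : K)) (U t (Complex.I • generator U v)) t := by
  have h1 : DifferentiableAt ℝ (fun t => U t (v : K)) 0 := v.2
  have h2 : Complex.I • generator U v = deriv (fun t => U t (v : K)) 0 := by
    change Complex.I • ((-Complex.I) • deriv (fun t => U t (v : K)) 0) = _
    rw [smul_smul]; simp
  rw [h2]
  have h3 : HasDerivAt (fun s => U (s - t) (v : K)) (deriv (fun t => U t (v : K)) 0) t := by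
    have h := h1.hasDerivAt
    have h' : HasDerivAt (fun t => U t (v : K)) (deriv (fun t => U t (v : K)) 0) (t - t) := by
      rwa [sub_self]
    exact h'.comp_sub_const t t
  have h4 : HasDerivAt (fun s => U t (U (s - t) (v : K)))
      (U t (deriv (fun t => U t (v : K)) 0)) t :=
    ((U t).restrictScalars ℝ).hasFDerivAt.comp_hasDerivAt t h3
  refine h4.congr_of_eventuallyEq (Eventually.of_forall fun s => ?_)
  change U s v = U t (U (s - t) v)
  rw [← mul_apply_eq_comp, ← hU.map_add, add_sub_cancel]

/-- The resolvent `(H - i a)⁻¹` of the generator `H`, as a Laplace transform. -/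
def laplaceResolvent (hU : IsUnitaryGroup U) (a : ℂ) (ha : a.re < 0) : K →L[ℂ] K :=
  LinearMap.mkContinuous
    { toFun := fun v => (-Complex.I) • ∫ t in Set.Ioi (0 : ℝ), Complex.exp (a * t) • U t v
      map_add' := fun v w => by
        have h : ∀ v, IntegrableOn (fun t : ℝ => Complex.exp (a * t) • U t v) (Set.Ioi 0) :=
          fun v => integrableOn_exp_smul ha (hU.continuous v) (fun t => (hU.norm_map t v).le) 0
        simp only [map_add, smul_add]
        rw [integral_add (h v) (h w), smul_add]
      map_smul' := fun c v => by
        simp only [map_smul, RingHom.id_apply, smul_comm _ c, integral_smul] }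
    (-a.re)⁻¹ fun v => by
      simp only [LinearMap.coe_mk, AddHom.coe_mk]
      rw [norm_smul, norm_neg, Complex.norm_I, one_mul]
      exact norm_integral_exp_smul_le ha fun t => (hU.norm_map t v).le

lemma laplaceResolvent_apply (hU : IsUnitaryGroup U) (a : ℂ) (ha : a.re < 0) (v : K) :
    laplaceResolvent hU a ha v =
      (-Complex.I) • ∫ t in Set.Ioi (0 : ℝ), Complex.exp (a * t) • U t v := rfl

/-- Integration by parts for `f(t) = U(t) v`, where `a f + f' = i U(t)(H - i a) v` and the boundary
term is `-v`. -/
lemma laplaceResolvent_generator (hU : IsUnitaryGroup U) (a : ℂ) (ha : a.re < 0)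
    (v : (generator U).domain) :
    laplaceResolvent hU a ha (generator U v - (Complex.I * a) • (v : K)) = v := by
  have h1 := integral_exp_smul_of_hasDerivAt ha (hU.hasDerivAt v) (hU.continuous _)
    (fun t => (hU.norm_map t v).le) (fun t => (hU.norm_map t _).le)
  have h2 : ∀ t, a • U t v + U t (Complex.I • generator U v) =
      Complex.I • U t (generator U v - (Complex.I * a) • (v : K)) := by
    intro t
    simp only [map_sub, map_smul, smul_sub, smul_smul]
    rw [← mul_assoc, Complex.I_mul_I]
    simp [add_comm]
  simp only [h2, smul_comm _ Complex.I] at h1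
  rw [integral_smul] at h1
  rw [laplaceResolvent_apply, neg_smul, h1, hU.map_zero]
  simp

lemma generator_laplaceResolvent (hU : IsUnitaryGroup U) (a : ℂ) (ha : a.re < 0) (v : K) :
    ∃ h : laplaceResolvent hU a ha v ∈ (generator U).domain,
      generator U ⟨_, h⟩ - (Complex.I * a) • laplaceResolvent hU a ha v = v := by
  set g : ℝ → K := fun t => Complex.exp (a * t) • U t v with hg
  have hgc : Continuous g := by
    have := hU.continuous v
    fun_prop
  have hgi : ∀ c, IntegrableOn g (Set.Ioi c) :=
    integrableOn_exp_smul ha (hU.continuous v) (fun t => (hU.norm_map t v).le)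
  set J : K := ∫ t in Set.Ioi (0 : ℝ), g t with hJ
  have hR : laplaceResolvent hU a ha v = (-Complex.I) • J := rfl
  -- `U(s)` shifts the integration variable, so `U(s) J` is explicit and differentiable in s even
  -- though v need not lie in the domain.
  have h1 : ∀ s : ℝ, U s J = Complex.exp (-a * s) • (J - ∫ t in (0 : ℝ)..s, g t) := by
    intro s
    have h2 : J - ∫ t in (0 : ℝ)..s, g t = ∫ t in Set.Ioi s, g t := by
      rw [hJ, ← intervalIntegral.integral_interval_add_Ioi (hgi 0) (hgi s)]
      abel
    have h3 : ∫ t in Set.Ioi s, g t = ∫ t in Set.Ioi (0 : ℝ), g (t + s) := by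
      have := (measurePreserving_add_right volume s).setIntegral_preimage_emb
        (measurableEmbedding_addRight s) g (Set.Ioi s)
      rw [← this]
      simp
    have h4 : ∀ t, U s (g t) = Complex.exp (-a * s) • g (t + s) := by
      intro t
      simp only [hg, map_smul, smul_smul, ← Complex.exp_add]
      rw [← mul_apply_eq_comp, ← hU.map_add, add_comm s t]
      push_cast
      congr 2
      ring
    rw [h2, h3, hJ, ← ContinuousLinearMap.integral_comp_comm _ (hgi 0), ← integral_smul]
    simp only [h4]
  have h5 : HasDerivAt (fun s => U s J) ((-a) • J - v) 0 := by
    have h6 : HasDerivAt (fun s : ℝ => ∫ t in (0 : ℝ)..s, g t) (g 0) 0 :=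
      intervalIntegral.integral_hasDerivAt_right (hgc.intervalIntegrable _ _)
        (hgc.stronglyMeasurableAtFilter _ _) hgc.continuousAt
    have h7 := (hasDerivAt_exp_mul_ofReal (-a) 0).smul (h6.const_sub J)
    have h8 : g 0 = v := by simp [hg, hU.map_zero]
    refine (h7.congr_of_eventuallyEq (Eventually.of_forall h1)).congr_deriv ?_
    simp only [intervalIntegral.integral_same, h8, Complex.ofReal_zero, mul_zero, Complex.exp_zero]
    simp [sub_eq_neg_add]
  have h9 : HasDerivAt (fun s => U s (laplaceResolvent hU a ha v))
      ((-Complex.I) • ((-a) • J - v)) 0 := by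
    simp only [hR, map_smul]
    exact h5.const_smul (-Complex.I)
  obtain ⟨hv, h10⟩ := generator_apply_of_hasDerivAt h9
  refine ⟨hv, ?_⟩
  rw [h10, hR]
  simp only [smul_sub, smul_smul]
  have e1 : -Complex.I * (-Complex.I * -a) = a := by
    linear_combination (-a) * Complex.I_mul_I
  have e2 : -Complex.I * -Complex.I = -1 := by
    linear_combination Complex.I_mul_I
  have e3 : Complex.I * a * -Complex.I = a := by
    linear_combination (-a) * Complex.I_mul_I
  rw [e1, e2, e3]
  simp

/-- A bound on the resolvent near a point puts this point into the resolvent set. -/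
lemma mem_unboundedResolventSet_of_norm_lt {T : K →ₗ.[ℂ] K} {z w : ℂ} {R : K →L[ℂ] K}
    (h1 : ∀ v, ∃ h : R v ∈ T.domain, T ⟨R v, h⟩ - z • R v = v)
    (h2 : ∀ v : T.domain, R (T v - z • (v : K)) = v) (hR : ‖(w - z) • R‖ < 1) :
    w ∈ unboundedResolventSet T := by
  -- Since `(T - w) R = 1 - (w - z) R = u`, the resolvent at w is `R u⁻¹`.
  obtain ⟨u, hu⟩ := isUnit_one_sub_of_norm_lt_one hR
  have hcomm : Commute R (u : K →L[ℂ] K) := by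
    rw [hu]; exact (Commute.one_right R).sub_right ((Commute.refl R).smul_right _)
  have hcomm' : Commute R ((u⁻¹ : (K →L[ℂ] K)ˣ) : K →L[ℂ] K) := hcomm.units_inv_right
  refine ⟨R * ((u⁻¹ : (K →L[ℂ] K)ˣ) : K →L[ℂ] K), fun v => ?_, fun v => ?_⟩
  · obtain ⟨h, h3⟩ := h1 (((u⁻¹ : (K →L[ℂ] K)ˣ) : K →L[ℂ] K) v)
    refine ⟨h, ?_⟩
    set y := ((u⁻¹ : (K →L[ℂ] K)ˣ) : K →L[ℂ] K) v with hy
    have h4 : (u : K →L[ℂ] K) y = v := by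
      rw [hy, ← mul_apply_eq_comp, Units.mul_inv, one_apply_eq_self]
    have h5 : (u : K →L[ℂ] K) y = y - (w - z) • R y := by rw [hu]; simp
    change T ⟨R y, h⟩ - w • R y = v
    have h6 : T ⟨R y, h⟩ - z • R y = y := h3
    rw [← h4, h5, sub_smul, ← sub_eq_zero, ← sub_eq_zero.2 h6]
    abel
  · rw [hcomm'.eq, mul_apply_eq_comp]
    have h5 : R (T v - w • (v : K)) = (u : K →L[ℂ] K) v := by
      have h6 : T v - w • (v : K) = (T v - z • (v : K)) - (w - z) • (v : K) := by
        rw [sub_smul]; abel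
      rw [h6, _root_.map_sub, h2, hu]
      simp
    rw [h5, ← mul_apply_eq_comp, Units.inv_mul, one_apply_eq_self]

end UnitaryGroup

end SpinLattice

end

noncomputable section

namespace SpinLattice

open MeasureTheory

/-! ### Spectral gaps of Hermitian matrices -/

section FiniteVolume

open scoped Matrix.Norms.L2Operator

variable {n : Type*} [Fintype n] [DecidableEq n] {M : Matrix n n ℂ}

/-- In an orthonormal eigenbasis `M - w` multiplies each coordinate by an eigenvalue minus w. -/
lemma mul_norm_le_norm_sub_smul (hM : M.IsHermitian) {w : ℂ} {δ : ℝ} (hδ : 0 ≤ δ)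
    (h : ∀ s ∈ spectrum ℝ M, δ ≤ ‖(s : ℂ) - w‖) (v : EuclideanSpace ℂ n) :
    δ * ‖v‖ ≤ ‖Matrix.toEuclideanLin M v - w • v‖ := by
  refine le_of_sq_le_sq ?_ (norm_nonneg _)
  rw [mul_pow, ← hM.eigenvectorBasis.sum_sq_norm_inner_right v,
    ← hM.eigenvectorBasis.sum_sq_norm_inner_right (Matrix.toEuclideanLin M v - w • v),
    Finset.mul_sum]
  refine Finset.sum_le_sum fun i _ => ?_
  have h1 : Matrix.toEuclideanLin M (hM.eigenvectorBasis i) =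
      (hM.eigenvalues i : ℂ) • hM.eigenvectorBasis i := by
    have := hM.mulVec_eigenvectorBasis i
    ext j
    simpa using congrFun this j
  have h2 : ⟪hM.eigenvectorBasis i, Matrix.toEuclideanLin M v⟫_ℂ =
      (hM.eigenvalues i : ℂ) * ⟪hM.eigenvectorBasis i, v⟫_ℂ := by
    rw [← Matrix.isSymmetric_toEuclideanLin_iff.2 hM (hM.eigenvectorBasis i) v, h1,
      inner_smul_left, Complex.conj_ofReal]
  rw [inner_sub_right, h2, inner_smul_right, ← sub_mul, norm_mul, mul_pow]
  gcongr
  exact h _ (hM.eigenvalues_mem_spectrum_real i)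

/-- Evaluation of a matrix at a vector, as a continuous linear map. -/
def evalCLM (ψ : EuclideanSpace ℂ n) : Matrix n n ℂ →L[ℂ] EuclideanSpace ℂ n :=
  LinearMap.toContinuousLinearMap
    ((LinearMap.applyₗ ψ).comp (Matrix.toEuclideanLin (𝕜 := ℂ) (m := n) (n := n)).toLinearMap)

lemma evalCLM_apply (ψ : EuclideanSpace ℂ n) (A : Matrix n n ℂ) :
    evalCLM ψ A = Matrix.toEuclideanLin A ψ := rfl

lemma toEuclideanLin_mul_apply (A B : Matrix n n ℂ) (v : EuclideanSpace ℂ n) :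
    Matrix.toEuclideanLin (A * B) v = Matrix.toEuclideanLin A (Matrix.toEuclideanLin B v) := by
  ext j
  simp [Matrix.mulVec_mulVec]

variable {E : ℝ} {ψ : EuclideanSpace ℂ n}

/-- Since `M ψ = E ψ`, `[M, B] ψ = (M - E) B ψ`: the evolved observable applied to ψ follows the
Schrödinger equation of `M - E`. -/
lemma hasDerivAt_evalCLM_conjFlow (hψ : Matrix.toEuclideanLin M ψ = (E : ℂ) • ψ)
    (A : Matrix n n ℂ) (t : ℝ) :
    HasDerivAt (fun t => evalCLM ψ (conjFlow M t A))
      (Complex.I • (Matrix.toEuclideanLin M (evalCLM ψ (conjFlow M t A)) -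
        (E : ℂ) • evalCLM ψ (conjFlow M t A))) t := by
  have h1 := ((evalCLM ψ).restrictScalars ℝ).hasFDerivAt.comp_hasDerivAt t
    (hasDerivAt_conjFlow M A t)
  refine h1.congr_deriv ?_
  rw [conjFlow_map_smul, conjFlow_commutator, conjFlow_self]
  simp only [ContinuousLinearMap.coe_restrictScalars', map_smul, map_sub, evalCLM_apply,
    toEuclideanLin_mul_apply, hψ]

/-- The derivative is i times the component of `(M - E) B ψ` along ψ, which vanishes because M is
Hermitian. -/
lemma inner_evalCLM_conjFlow (hM : M.IsHermitian)
    (hψ : Matrix.toEuclideanLin M ψ = (E : ℂ) • ψ) (A : Matrix n n ℂ) (t : ℝ) :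
    ⟪ψ, evalCLM ψ (conjFlow M t A)⟫_ℂ = ⟪ψ, evalCLM ψ A⟫_ℂ := by
  have h1 : ∀ t, HasDerivAt (fun t => ⟪ψ, evalCLM ψ (conjFlow M t A)⟫_ℂ) 0 t := by
    intro t
    have h2 := ((innerSL ℂ ψ).restrictScalars ℝ).hasFDerivAt.comp_hasDerivAt t
      (hasDerivAt_evalCLM_conjFlow hψ A t)
    refine h2.congr_deriv ?_
    simp only [ContinuousLinearMap.coe_restrictScalars', innerSL_apply_apply, inner_smul_right,
      inner_sub_right]
    rw [← Matrix.isSymmetric_toEuclideanLin_iff.2 hM ψ, hψ, inner_smul_left, Complex.conj_ofReal]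
    simp
  have h3 := is_const_of_deriv_eq_zero (fun t => (h1 t).differentiableAt)
    (fun t => (h1 t).deriv) t 0
  simpa [conjFlow_zero] using h3

lemma norm_evalCLM_conjFlow_le (hM : M.IsHermitian) (ψ : EuclideanSpace ℂ n) (A : Matrix n n ℂ)
    (t : ℝ) : ‖evalCLM ψ (conjFlow M t A)‖ ≤ ‖evalCLM ψ‖ * ‖A‖ := by
  refine ((evalCLM ψ).le_opNorm _).trans_eq ?_
  rw [norm_conjFlow (show IsSelfAdjoint M from hM)]

/-- The finite-volume resolvent estimate for a spectral gap. -/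
lemma mul_norm_integral_evalCLM_conjFlow_le (hM : M.IsHermitian)
    (hψ : Matrix.toEuclideanLin M ψ = (E : ℂ) • ψ) {a : ℂ} (ha : a.re < 0) {δ : ℝ} (hδ : 0 ≤ δ)
    (h : ∀ s ∈ spectrum ℝ M, δ ≤ ‖(s : ℂ) - (E + Complex.I * a)‖) (A : Matrix n n ℂ) :
    δ * ‖∫ t in Set.Ioi (0 : ℝ), Complex.exp (a * t) • evalCLM ψ (conjFlow M t A)‖ ≤
      ‖evalCLM ψ A‖ := by
  set T : EuclideanSpace ℂ n →L[ℂ] EuclideanSpace ℂ n :=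
    LinearMap.toContinuousLinearMap (Matrix.toEuclideanLin M) -
      ((E : ℂ) + Complex.I * a) • ContinuousLinearMap.id ℂ _ with hT
  have hTv : ∀ v, T v = Matrix.toEuclideanLin M v - ((E : ℂ) + Complex.I * a) • v := fun v => rfl
  set f : ℝ → EuclideanSpace ℂ n := fun t => evalCLM ψ (conjFlow M t A) with hf
  have hfc : Continuous f := (evalCLM ψ).continuous.comp (continuous_conjFlow M A)
  have hfC : ∀ t, ‖f t‖ ≤ ‖evalCLM ψ‖ * ‖A‖ := norm_evalCLM_conjFlow_le hM ψ A
  -- This identity makes the integrand of the integration by parts `e^{at} i T f(t)`, so `i T ∫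
  -- e^{at} f = -f(0)`.
  have hTC : ∀ v, Complex.I • T v =
      a • v + Complex.I • (Matrix.toEuclideanLin M v - (E : ℂ) • v) := by
    intro v
    have e : Complex.I * (Complex.I * a) = -a := by
      linear_combination a * Complex.I_mul_I
    rw [hTv, add_smul, smul_sub, smul_add, smul_smul Complex.I (Complex.I * a), e, smul_sub,
      neg_smul]
    abel
  have hf'eq : ∀ t, Complex.I • (Matrix.toEuclideanLin M (f t) - (E : ℂ) • f t) =
      Complex.I • T (f t) - a • f t := fun t => by rw [hTC]; abel
  have h1 := integral_exp_smul_of_hasDerivAt ha (f := f)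
    (f' := fun t => Complex.I • T (f t) - a • f t)
    (fun t => (hasDerivAt_evalCLM_conjFlow hψ A t).congr_deriv (hf'eq t))
    (by fun_prop) hfC (C' := ‖T‖ * (‖evalCLM ψ‖ * ‖A‖) + ‖a‖ * (‖evalCLM ψ‖ * ‖A‖))
    (fun t => by
      refine (norm_sub_le _ _).trans (add_le_add ?_ ?_)
      · rw [norm_smul, Complex.norm_I, one_mul]
        exact (T.le_opNorm _).trans (mul_le_mul_of_nonneg_left (hfC t) (norm_nonneg _))
      · rw [norm_smul]
        exact mul_le_mul_of_nonneg_left (hfC t) (norm_nonneg _))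
  have h2 : ∀ t : ℝ, Complex.exp (a * t) • (a • f t + (Complex.I • T (f t) - a • f t)) =
      (Complex.I • T) (Complex.exp (a * t) • f t) := by
    intro t
    rw [add_sub_cancel, map_smul]
    rfl
  simp only [h2] at h1
  rw [ContinuousLinearMap.integral_comp_comm _ (integrableOn_exp_smul ha hfc hfC 0)] at h1
  refine (mul_norm_le_norm_sub_smul hM hδ h _).trans_eq ?_
  rw [← hTv]
  have h3 := congrArg norm h1
  rw [smul_apply, norm_smul, Complex.norm_I, one_mul, norm_neg] at h3
  rw [h3, hf]
  simp only [conjFlow_zero]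

end FiniteVolume

/-! ### Ground states of local Hamiltonians as states of the quasilocal algebra -/

section LocalStates

attribute [local instance] isClosed_quasiLocalSubalgebra

open scoped Matrix.Norms.L2Operator

variable {d ℓ : ℕ} {Φ : Interaction d ℓ} {Λ : Finset (Site d)} {ψ : LocalSpace ℓ Λ}
  {φ : WeakDual ℂ (QuasiLocalAlgebra d ℓ)}

lemma localDynamics_localObs (Φ : Interaction d ℓ) (Λ : Finset (Site d)) (t : ℝ)
    (A : LocalAlg ℓ Λ) :
    Φ.localDynamics Λ t (localObs Λ A) = localObs Λ (conjFlow (Φ.hamiltonian Λ) t A) :=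
  (map_conjFlow (localObsHom ℓ Λ) _ _ t).symm

lemma apply_localDynamics_localObs [NeZero ℓ] (hψ : Φ.IsGroundVector Λ ψ)
    (hφ : ∀ A : LocalAlg ℓ Λ, φ (localObs Λ A) = ⟪ψ, Matrix.toEuclideanLin A ψ⟫_ℂ)
    {X : Finset (Site d)} (hX : X ⊆ Λ) (A : LocalAlg ℓ X) (t : ℝ) :
    φ (Φ.localDynamics Λ t (localObs X A)) = φ (localObs X A) := by
  rw [← localObs_extendMatrix hX, localDynamics_localObs, hφ, hφ]
  exact inner_evalCLM_conjFlow (isHermitian_hamiltonian Φ Λ) hψ.2 _ t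

lemma apply_star_localObs_mul_self
    (hφ : ∀ A : LocalAlg ℓ Λ, φ (localObs Λ A) = ⟪ψ, Matrix.toEuclideanLin A ψ⟫_ℂ)
    (A : LocalAlg ℓ Λ) :
    φ (star (localObs Λ A) * localObs Λ A) = ((‖evalCLM ψ A‖ ^ 2 : ℝ) : ℂ) := by
  have h1 : star (localObs Λ A) * localObs Λ A = localObs Λ (star A * A) := by
    change star (localObsHom ℓ Λ A) * localObsHom ℓ Λ A = localObsHom ℓ Λ (star A * A)
    rw [map_mul, map_star]
  rw [h1, hφ, toEuclideanLin_mul_apply, Matrix.star_eq_conjTranspose,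
    Matrix.toEuclideanLin_conjTranspose_eq_adjoint, LinearMap.adjoint_inner_right,
    evalCLM_apply, inner_self_eq_norm_sq_to_K]
  simp

/-- The vector estimate rewritten through `‖A ψ‖² = φ(A⋆ A)`, so that the finite-volume Hilbert
space disappears from the statement. -/
lemma sq_mul_apply_integral_localDynamics_le [NeZero ℓ] (hψ : Φ.IsGroundVector Λ ψ)
    (hφ : ∀ A : LocalAlg ℓ Λ, φ (localObs Λ A) = ⟪ψ, Matrix.toEuclideanLin A ψ⟫_ℂ)
    {a : ℂ} (ha : a.re < 0) {δ : ℝ} (hδ : 0 ≤ δ)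
    (h : ∀ s ∈ spectrum ℝ (Φ.hamiltonian Λ), δ ≤ ‖(s : ℂ) - (Φ.groundEnergy Λ + Complex.I * a)‖)
    {X : Finset (Site d)} (hX : X ⊆ Λ) (A : LocalAlg ℓ X) :
    δ ^ 2 * (φ (star (∫ t in Set.Ioi (0 : ℝ), Complex.exp (a * t) •
        Φ.localDynamics Λ t (localObs X A)) *
      ∫ t in Set.Ioi (0 : ℝ), Complex.exp (a * t) • Φ.localDynamics Λ t (localObs X A))).re ≤
      (φ (star (localObs X A) * localObs X A)).re := by
  rw [← localObs_extendMatrix hX]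
  set A' := extendMatrix hX A
  have hM := isHermitian_hamiltonian Φ Λ
  have hint : IntegrableOn (fun t : ℝ => Complex.exp (a * t) •
      conjFlow (Φ.hamiltonian Λ) t A') (Set.Ioi 0) :=
    integrableOn_exp_smul ha (continuous_conjFlow _ A')
      (fun t => (norm_conjFlow (show IsSelfAdjoint _ from hM) t A').le) 0
  have h1 : (∫ t in Set.Ioi (0 : ℝ), Complex.exp (a * t) •
        Φ.localDynamics Λ t (localObs Λ A')) =
      localObs Λ (∫ t in Set.Ioi (0 : ℝ), Complex.exp (a * t) •
        conjFlow (Φ.hamiltonian Λ) t A') := by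
    let L : LocalAlg ℓ Λ →L[ℂ] QuasiLocalAlgebra d ℓ :=
      LinearMap.toContinuousLinearMap (localObsHom ℓ Λ : LocalAlg ℓ Λ →ₐ[ℂ] _).toLinearMap
    have h2 := L.integral_comp_comm hint
    refine Eq.trans ?_ h2
    refine integral_congr_ae (Eventually.of_forall fun t => ?_)
    simp only [localDynamics_localObs, map_smul]
    rfl
  rw [h1, apply_star_localObs_mul_self hφ, apply_star_localObs_mul_self hφ, Complex.ofReal_re,
    Complex.ofReal_re, ← mul_pow, ← ContinuousLinearMap.integral_comp_comm _ hint]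
  simp only [map_smul]
  have := mul_norm_integral_evalCLM_conjFlow_le hM hψ.2 ha hδ h A'
  gcongr

end LocalStates

/-! ### Limits of ground states -/

section Limits

attribute [local instance] isClosed_quasiLocalSubalgebra

variable {d ℓ : ℕ} {Φ : Interaction d ℓ} {τ : ℝ → QuasiLocalAlgebra d ℓ → QuasiLocalAlgebra d ℓ}

lemma IsState.norm_apply_le {φ : WeakDual ℂ (QuasiLocalAlgebra d ℓ)} (hφ : IsState φ)
    (A : QuasiLocalAlgebra d ℓ) : ‖φ A‖ ≤ ‖A‖ :=
  norm_apply_le_of_state (φ := (WeakDual.toStrongDual φ).toLinearMap) hφ.1 hφ.2 A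

/-- States are uniformly contractive, so weak-⋆ convergence of states combines with norm convergence
of their arguments. -/
lemma tendsto_state_apply {ι : Type*} {l : Filter ι} {φ : ι → WeakDual ℂ (QuasiLocalAlgebra d ℓ)}
    (hφ : ∀ i, IsState (φ i)) {φ₀ : WeakDual ℂ (QuasiLocalAlgebra d ℓ)}
    (h : Tendsto φ l (𝓝 φ₀)) {A : ι → QuasiLocalAlgebra d ℓ} {A₀ : QuasiLocalAlgebra d ℓ}
    (hA : Tendsto A l (𝓝 A₀)) : Tendsto (fun i => φ i (A i)) l (𝓝 (φ₀ A₀)) := by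
  have h1 : Tendsto (fun i => φ i A₀) l (𝓝 (φ₀ A₀)) :=
    ((WeakDual.eval_continuous A₀).tendsto φ₀).comp h
  have h2 : Tendsto (fun i => φ i (A i - A₀)) l (𝓝 0) := by
    refine squeeze_zero_norm (fun i => (hφ i).norm_apply_le _) ?_
    simpa using (hA.sub_const A₀).norm
  simpa using h2.add h1

variable {ψ : (Λ : Finset (Site d)) → LocalSpace ℓ Λ}
  {ωΛ : Finset (Site d) → WeakDual ℂ (QuasiLocalAlgebra d ℓ)}
  {ω : WeakDual ℂ (QuasiLocalAlgebra d ℓ)}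

lemma apply_globalDynamics_eq [NeZero ℓ] (hτ : Φ.IsGlobalDynamics τ)
    (hψ : ∀ Λ, Φ.IsGroundVector Λ (ψ Λ))
    (hωΛ : ∀ Λ, IsState (ωΛ Λ) ∧
      ∀ A : LocalAlg ℓ Λ, ωΛ Λ (localObs Λ A) = ⟪ψ Λ, Matrix.toEuclideanLin A (ψ Λ)⟫_ℂ)
    (hω : MapClusterPt ω atTop ωΛ) (t : ℝ) (A : QuasiLocalAlgebra d ℓ) :
    ω (τ t A) = ω A := by
  -- The limit point is an honest limit along an ultrafilter u finer than the net, and everything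
  -- that holds for all large Λ holds along u.
  obtain ⟨u, hu, hlim⟩ := mapClusterPt_iff_ultrafilter.1 hω
  refine dense_localObs.induction (P := fun A => ω (τ t A) = ω A) ?_ ?_ A
  · rintro _ ⟨X, B, rfl⟩
    have h1 := tendsto_state_apply (fun Λ => (hωΛ Λ).1) hlim ((hτ t (localObs X B)).mono_left hu)
    have h2 := tendsto_state_apply (fun Λ => (hωΛ Λ).1) hlim
      (tendsto_const_nhds (x := localObs X B))
    refine tendsto_nhds_unique h1 (h2.congr' ?_)
    filter_upwards [hu (eventually_ge_atTop X)] with Λ hΛ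
    exact (apply_localDynamics_localObs (hψ Λ) (hωΛ Λ).2 hΛ B t).symm
  · have hc : Continuous (τ t) := by
      refine (LipschitzWith.of_dist_le_mul (K := 1) fun A B => ?_).continuous
      rw [dist_eq_norm, dist_eq_norm, ← hτ.map_sub, hτ.norm_map]
      simp
    exact isClosed_eq ((map_continuous ω).comp hc) (map_continuous ω)

lemma sq_mul_apply_integral_globalDynamics_le [NeZero ℓ] (hτ : Φ.IsGlobalDynamics τ)
    (hψ : ∀ Λ, Φ.IsGroundVector Λ (ψ Λ))
    (hωΛ : ∀ Λ, IsState (ωΛ Λ) ∧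
      ∀ A : LocalAlg ℓ Λ, ωΛ Λ (localObs Λ A) = ⟪ψ Λ, Matrix.toEuclideanLin A (ψ Λ)⟫_ℂ)
    (hω : MapClusterPt ω atTop ωΛ) {a : ℂ} (ha : a.re < 0) {δ : ℝ} (hδ : 0 ≤ δ)
    {Λ₀ : Finset (Site d)}
    (h : ∀ Λ, Λ₀ ⊆ Λ → ∀ s ∈ spectrum ℝ (Φ.hamiltonian Λ),
      δ ≤ ‖(s : ℂ) - (Φ.groundEnergy Λ + Complex.I * a)‖)
    (X : Finset (Site d)) (A : LocalAlg ℓ X) :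
    δ ^ 2 * (ω (star (∫ t in Set.Ioi (0 : ℝ), Complex.exp (a * t) • τ t (localObs X A)) *
      ∫ t in Set.Ioi (0 : ℝ), Complex.exp (a * t) • τ t (localObs X A))).re ≤
      (ω (star (localObs X A) * localObs X A)).re := by
  obtain ⟨u, hu, hlim⟩ := mapClusterPt_iff_ultrafilter.1 hω
  -- Dominated convergence needs a countably generated filter. The net of finite regions provides
  -- one because the lattice is countable; the ultrafilter enters only afterwards.
  have hB : Tendsto (fun Λ => ∫ t in Set.Ioi (0 : ℝ), Complex.exp (a * t) •
      Φ.localDynamics Λ t (localObs X A)) atTop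
      (𝓝 (∫ t in Set.Ioi (0 : ℝ), Complex.exp (a * t) • τ t (localObs X A))) := by
    refine tendsto_integral_filter_of_dominated_convergence
      (fun t => Real.exp (a.re * t) * ‖localObs X A‖) (Eventually.of_forall fun Λ => ?_)
      (Eventually.of_forall fun Λ => Eventually.of_forall fun t => ?_)
      ((integrableOn_exp_mul_Ioi ha 0).mul_const _)
      (Eventually.of_forall fun t => (hτ t _).const_smul _)
    · have hc : Continuous fun t => Φ.localDynamics Λ t (localObs X A) :=
        continuous_conjFlow (localObs Λ (Φ.hamiltonian Λ)) (localObs X A)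
      exact Continuous.aestronglyMeasurable (by fun_prop)
    · rw [norm_smul, Complex.norm_exp, Φ.localDynamics_eq,
        norm_conjFlow (isSelfAdjoint_localObs_hamiltonian Φ Λ)]
      simp
  have hB' := hB.mono_left hu
  have h1 := tendsto_state_apply (fun Λ => (hωΛ Λ).1) hlim (hB'.star.mul hB')
  have h2 := tendsto_state_apply (fun Λ => (hωΛ Λ).1) hlim
    (tendsto_const_nhds (x := star (localObs X A) * localObs X A))
  refine le_of_tendsto_of_tendsto
    (((Complex.continuous_re.tendsto _).comp h1).const_mul (δ ^ 2))
    ((Complex.continuous_re.tendsto _).comp h2) ?_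
  filter_upwards [hu (eventually_ge_atTop (X ∪ Λ₀))] with Λ hΛ
  exact sq_mul_apply_integral_localDynamics_le (hψ Λ) (hωΛ Λ).2 ha hδ
    (h Λ (Finset.union_subset_right hΛ)) (Finset.union_subset_left hΛ) A

end Limits

end SpinLattice

end

noncomputable section

namespace SpinLattice

open MeasureTheory

/-! ### The GNS Hamiltonian -/

section GNS

attribute [local instance] isClosed_quasiLocalSubalgebra

variable {d ℓ : ℕ} {ω : WeakDual ℂ (QuasiLocalAlgebra d ℓ)}
  {K : Type*} [NormedAddCommGroup K] [InnerProductSpace ℂ K] [CompleteSpace K]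

namespace GNSTriple

lemma norm_sq_apply (G : GNSTriple ω K) (A : QuasiLocalAlgebra d ℓ) :
    ‖G.π A G.Ω‖ ^ 2 = (ω (star A * A)).re := by
  rw [← G.inner_eq, map_mul, map_star, mul_apply_eq_comp, ContinuousLinearMap.star_eq_adjoint,
    ContinuousLinearMap.adjoint_inner_right, inner_self_eq_norm_sq_to_K]
  norm_cast

/-- The map `A ↦ π(A) Ω`. -/
def orbitMap (G : GNSTriple ω K) : QuasiLocalAlgebra d ℓ →ₗ[ℂ] K where
  toFun A := G.π A G.Ω
  map_add' A B := by simp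
  map_smul' c A := by simp

lemma denseRange_orbitMap (G : GNSTriple ω K) : DenseRange G.orbitMap := G.cyclic

lemma orbitMap_apply (G : GNSTriple ω K) (A : QuasiLocalAlgebra d ℓ) :
    G.orbitMap A = G.π A G.Ω := rfl

lemma norm_π_apply_le (G : GNSTriple ω K) (A : QuasiLocalAlgebra d ℓ) : ‖G.π A‖ ≤ ‖A‖ :=
  NonUnitalStarAlgHom.norm_apply_le G.π A

lemma continuous_orbitMap (G : GNSTriple ω K) : Continuous G.orbitMap :=
  AddMonoidHomClass.continuous_of_bound G.orbitMap ‖G.Ω‖ fun A => by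
    rw [orbitMap_apply, mul_comm]
    exact (G.π A).le_of_opNorm_le (G.norm_π_apply_le A) _

lemma dense_local_orbit (G : GNSTriple ω K) :
    Dense {v | ∃ (X : Finset (Site d)) (A : LocalAlg ℓ X), G.orbitMap (localObs X A) = v} := by
  refine (G.denseRange_orbitMap.dense_image G.continuous_orbitMap dense_localObs).mono ?_
  rintro _ ⟨_, ⟨X, A, rfl⟩, rfl⟩
  exact ⟨X, A, rfl⟩

end GNSTriple

variable {Φ : Interaction d ℓ} {τ : ℝ → QuasiLocalAlgebra d ℓ → QuasiLocalAlgebra d ℓ}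

/-- The unitary implementing an invariant dynamics in the GNS representation. -/
def gnsUnitary (G : GNSTriple ω K) (hτ : Φ.IsGlobalDynamics τ) (t : ℝ) : K →L[ℂ] K :=
  LinearMap.extendOfNorm
    { toFun := fun A => G.orbitMap (τ t A)
      map_add' := fun A B => by rw [hτ.map_add, map_add]
      map_smul' := fun c A => by rw [hτ.map_smul, map_smul]; rfl }
    G.orbitMap

lemma norm_orbitMap_globalDynamics (G : GNSTriple ω K) (hτ : Φ.IsGlobalDynamics τ)
    (hinv : ∀ t A, ω (τ t A) = ω A) (t : ℝ) (A : QuasiLocalAlgebra d ℓ) :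
    ‖G.orbitMap (τ t A)‖ = ‖G.orbitMap A‖ := by
  have h1 : ‖G.orbitMap (τ t A)‖ ^ 2 = ‖G.orbitMap A‖ ^ 2 := by
    rw [G.orbitMap_apply, G.orbitMap_apply, G.norm_sq_apply, G.norm_sq_apply, ← hτ.map_star,
      ← hτ.map_mul, hinv]
  exact (sq_eq_sq₀ (norm_nonneg _) (norm_nonneg _)).1 h1

lemma gnsUnitary_orbitMap (G : GNSTriple ω K) (hτ : Φ.IsGlobalDynamics τ)
    (hinv : ∀ t A, ω (τ t A) = ω A) (t : ℝ) (A : QuasiLocalAlgebra d ℓ) :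
    gnsUnitary G hτ t (G.orbitMap A) = G.orbitMap (τ t A) :=
  LinearMap.extendOfNorm_eq G.denseRange_orbitMap ⟨1, fun A => by
    rw [one_mul]; exact (norm_orbitMap_globalDynamics G hτ hinv t A).le⟩ A

lemma ext_orbitMap (G : GNSTriple ω K) {S T : K →L[ℂ] K}
    (h : ∀ A, S (G.orbitMap A) = T (G.orbitMap A)) : S = T :=
  ContinuousLinearMap.ext fun v =>
    G.denseRange_orbitMap.induction_on (p := fun v => S v = T v) v
      (isClosed_eq S.continuous T.continuous) h

/-- Invariance of ω makes each `U(t)` isometric, and `U(-t)` is a right inverse, which forces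
unitarity. Strong continuity holds on the orbit of Ω and passes to uniform limits. -/
lemma isUnitaryGroup_gnsUnitary (G : GNSTriple ω K) (hτ : Φ.IsGlobalDynamics τ)
    (hinv : ∀ t A, ω (τ t A) = ω A) (hcont : ∀ A, Continuous fun t => τ t A) :
    IsUnitaryGroup (gnsUnitary G hτ) := by
  have hzero : gnsUnitary G hτ 0 = 1 := ext_orbitMap G fun A => by
    rw [gnsUnitary_orbitMap G hτ hinv, hτ.zero_time, one_apply_eq_self]
  have hadd : ∀ s t, gnsUnitary G hτ (s + t) = gnsUnitary G hτ s * gnsUnitary G hτ t :=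
    fun s t => ext_orbitMap G fun A => by
      rw [mul_apply_eq_comp, gnsUnitary_orbitMap G hτ hinv, gnsUnitary_orbitMap G hτ hinv,
        gnsUnitary_orbitMap G hτ hinv, hτ.add_time]
  have hnorm : ∀ t v, ‖gnsUnitary G hτ t v‖ = ‖v‖ := fun t v =>
    G.denseRange_orbitMap.induction_on (p := fun v => ‖gnsUnitary G hτ t v‖ = ‖v‖) v
      (isClosed_eq (gnsUnitary G hτ t).continuous.norm continuous_norm) fun A => by
        rw [gnsUnitary_orbitMap G hτ hinv, norm_orbitMap_globalDynamics G hτ hinv]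
  refine ⟨fun t => ?_, hzero, hadd, fun v => ?_⟩
  · have h1 : star (gnsUnitary G hτ t) * gnsUnitary G hτ t = 1 :=
      (ContinuousLinearMap.norm_map_iff_adjoint_comp_self _).1 (hnorm t)
    have h2 : gnsUnitary G hτ t * gnsUnitary G hτ (-t) = 1 := by
      rw [← hadd, add_neg_cancel, hzero]
    have h3 := left_inv_eq_right_inv h1 h2
    exact Unitary.mem_iff.2 ⟨h1, by rw [h3, h2]⟩
  · refine continuous_of_uniform_approx_of_continuous fun u hu => ?_
    obtain ⟨ε, hε, hεu⟩ := Metric.mem_uniformity_dist.1 hu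
    obtain ⟨A, hA⟩ := G.denseRange_orbitMap.exists_dist_lt v hε
    refine ⟨fun t => G.orbitMap (τ t A), G.continuous_orbitMap.comp (hcont A), fun t => hεu ?_⟩
    change dist _ (G.orbitMap (τ t A)) < ε
    rw [← gnsUnitary_orbitMap G hτ hinv, dist_eq_norm, ← map_sub, hnorm, ← dist_eq_norm]
    exact hA

/-- On `π(B) Ω` the left side gives `π(τ_t(A τ_{-t}(B))) Ω = π(τ_t(A) B) Ω`. -/
lemma gnsUnitary_implements (G : GNSTriple ω K) (hτ : Φ.IsGlobalDynamics τ)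
    (hinv : ∀ t A, ω (τ t A) = ω A) (hcont : ∀ A, Continuous fun t => τ t A) (t : ℝ)
    (A : QuasiLocalAlgebra d ℓ) :
    gnsUnitary G hτ t * G.π A * star (gnsUnitary G hτ t) = G.π (τ t A) := by
  have hU := isUnitaryGroup_gnsUnitary G hτ hinv hcont
  have h2 : gnsUnitary G hτ t * gnsUnitary G hτ (-t) = 1 := by
    rw [← hU.map_add, add_neg_cancel, hU.map_zero]
  have h3 := left_inv_eq_right_inv (Unitary.mem_iff.1 (hU.mem_unitary t)).1 h2
  refine ext_orbitMap G fun B => ?_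
  have h4 : ∀ A B, G.π A (G.orbitMap B) = G.orbitMap (A * B) := fun A B => by
    rw [G.orbitMap_apply, G.orbitMap_apply, map_mul, mul_apply_eq_comp]
  rw [h3, mul_apply_eq_comp, mul_apply_eq_comp, gnsUnitary_orbitMap G hτ hinv, h4,
    gnsUnitary_orbitMap G hτ hinv, hτ.map_mul, ← hτ.add_time, add_neg_cancel, hτ.zero_time, h4]

lemma GNSTriple.orbitMap_one (G : GNSTriple ω K) : G.orbitMap 1 = G.Ω := by
  rw [G.orbitMap_apply, map_one, one_apply_eq_self]

lemma gnsUnitary_cyclic (G : GNSTriple ω K) (hτ : Φ.IsGlobalDynamics τ)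
    (hinv : ∀ t A, ω (τ t A) = ω A) (t : ℝ) : gnsUnitary G hτ t G.Ω = G.Ω := by
  rw [← G.orbitMap_one, gnsUnitary_orbitMap G hτ hinv, hτ.map_one]

/-- A unitary that implements the dynamics and fixes the cyclic vector is determined on orbits. -/
lemma apply_orbitMap_of_implements (G : GNSTriple ω K) {U : K →L[ℂ] K}
    (hU : U ∈ unitary (K →L[ℂ] K)) (hΩ : U G.Ω = G.Ω) {A B : QuasiLocalAlgebra d ℓ}
    (h : U * G.π A * star U = G.π B) : U (G.orbitMap A) = G.orbitMap B := by
  have h1 : star U G.Ω = G.Ω := by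
    conv_lhs => rw [← hΩ]
    rw [← mul_apply_eq_comp, (Unitary.mem_iff.1 hU).1, one_apply_eq_self]
  rw [G.orbitMap_apply, G.orbitMap_apply, ← h, mul_apply_eq_comp, mul_apply_eq_comp, h1]

/-- Uniform finite-volume gaps bound the resolvent of the GNS Hamiltonian. -/
lemma norm_laplaceResolvent_le_of_gap (G : GNSTriple ω K) (hτ : Φ.IsGlobalDynamics τ)
    (hcont : ∀ A, Continuous fun t => τ t A) {U : ℝ → K →L[ℂ] K} (hU : IsUnitaryGroup U)
    (hUτ : ∀ t A, U t (G.orbitMap A) = G.orbitMap (τ t A)) {a : ℂ} (ha : a.re < 0) {δ : ℝ}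
    (hδ : 0 < δ)
    (h : ∀ (X : Finset (Site d)) (A : LocalAlg ℓ X),
      δ ^ 2 * (ω (star (∫ t in Set.Ioi (0 : ℝ), Complex.exp (a * t) • τ t (localObs X A)) *
        ∫ t in Set.Ioi (0 : ℝ), Complex.exp (a * t) • τ t (localObs X A))).re ≤
        (ω (star (localObs X A) * localObs X A)).re) :
    ‖laplaceResolvent hU a ha‖ ≤ δ⁻¹ := by
  refine ContinuousLinearMap.opNorm_le_bound _ (by positivity) fun v => ?_
  refine G.dense_local_orbit.induction
    (P := fun v => ‖laplaceResolvent hU a ha v‖ ≤ δ⁻¹ * ‖v‖) ?_ ?_ v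
  · rintro _ ⟨X, A, rfl⟩
    let L : QuasiLocalAlgebra d ℓ →L[ℂ] K := ⟨G.orbitMap, G.continuous_orbitMap⟩
    have h1 : laplaceResolvent hU a ha (G.orbitMap (localObs X A)) = (-Complex.I) •
        G.orbitMap (∫ t in Set.Ioi (0 : ℝ), Complex.exp (a * t) • τ t (localObs X A)) := by
      have h2 := L.integral_comp_comm (integrableOn_exp_smul ha (hcont (localObs X A))
        (fun t => (hτ.norm_map t _).le) 0)
      rw [laplaceResolvent_apply]
      congr 1
      refine Eq.trans (integral_congr_ae (Eventually.of_forall fun t => ?_)) h2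
      simp only [hUτ, map_smul]
      rfl
    rw [h1, norm_smul, norm_neg, Complex.norm_I, one_mul, inv_mul_eq_div, le_div_iff₀ hδ]
    refine le_of_sq_le_sq ?_ (norm_nonneg _)
    rw [mul_pow, mul_comm, G.orbitMap_apply, G.orbitMap_apply, G.norm_sq_apply, G.norm_sq_apply]
    exact h X A
  · exact isClosed_le (laplaceResolvent hU a ha).continuous.norm
      (continuous_const.mul continuous_norm)

end GNS

end SpinLattice

end

/-! ### The gap of the GNS Hamiltonian -/

open SpinLattice in
theorem proposition5p4 (d ℓ : ℕ) [NeZero ℓ] (N : AddGroupNorm (Site d)) (F : ℝ → ℝ)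
    (hF : IsDecayFunction N F) (lam : ℝ) (hlam : 0 < lam)
    (Φ : Interaction d ℓ) (hΦ : Φ.TranslationInvariant) (hΦF : Φ.decayNorm N F lam < ⊤)
    (ψ : (Λ : Finset (Site d)) → LocalSpace ℓ Λ) (hψ : ∀ Λ, Φ.IsGroundVector Λ (ψ Λ))
    (ωΛ : Finset (Site d) → WeakDual ℂ (QuasiLocalAlgebra d ℓ))
    (hωΛ : ∀ Λ, IsState (ωΛ Λ) ∧
      ∀ A : LocalAlg ℓ Λ, ωΛ Λ (localObs Λ A) = ⟪ψ Λ, Matrix.toEuclideanLin A (ψ Λ)⟫_ℂ)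
    (ω : WeakDual ℂ (QuasiLocalAlgebra d ℓ)) (hω : MapClusterPt ω atTop ωΛ)
    (E ε : ℝ) (hε : 0 < ε) (Λ₀ : Finset (Site d))
    (hgap : ∀ Λ, Λ₀ ⊆ Λ →
      ((fun s => Φ.groundEnergy Λ + s) '' Set.Ioo (E - ε) (E + ε)) ∩
        spectrum ℝ (Φ.hamiltonian Λ) = ∅)
    {K : Type*} [NormedAddCommGroup K] [InnerProductSpace ℂ K] [CompleteSpace K]
    (G : GNSTriple ω K) :
    (∃! H : K →ₗ.[ℂ] K, Φ.IsGNSHamiltonian G H) ∧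
    ∀ H : K →ₗ.[ℂ] K, Φ.IsGNSHamiltonian G H →
      (E : ℂ) ∉ unboundedSpectrum H ∧
      ∀ E' ∈ Set.Ioo (E - ε) (E + ε), (E' : ℂ) ∉ unboundedSpectrum H := by
  obtain ⟨C, hC, hpair⟩ := Interaction.exists_hasPairDecay hF hlam hΦ hΦF
  obtain ⟨τ, hτ⟩ := Interaction.exists_isGlobalDynamics hF hC hpair
  have hcont := hτ.continuous hpair
  have hinv := apply_globalDynamics_eq hτ hψ hωΛ hω
  have hU := isUnitaryGroup_gnsUnitary G hτ hinv hcont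
  refine ⟨⟨generator (gnsUnitary G hτ), ⟨τ, _, hτ, hU, gnsUnitary_implements G hτ hinv hcont,
    gnsUnitary_cyclic G hτ hinv, rfl⟩, ?_⟩, ?_⟩
  -- Any admissible group is forced on the dense orbit of Ω, so the groups agree and with them their
  -- generators.
  · rintro H ⟨τ', U', hτ', hU', himp, hΩ, rfl⟩
    obtain rfl := hτ'.unique hτ
    congr 1
    funext t
    refine ext_orbitMap G fun A => ?_
    rw [gnsUnitary_orbitMap G hτ hinv]
    exact apply_orbitMap_of_implements G (hU'.mem_unitary t) (hΩ t) (himp t A)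
  · rintro H ⟨τ', U', hτ', hU', himp, hΩ, rfl⟩
    obtain rfl := hτ'.unique hτ
    have key : ∀ E' ∈ Set.Ioo (E - ε) (E + ε), (E' : ℂ) ∉ unboundedSpectrum (generator U') := by
      intro E' hE'
      obtain ⟨δ, hδ, hδ1, hδ2⟩ : ∃ δ, 0 < δ ∧ δ ≤ E' - (E - ε) ∧ δ ≤ E + ε - E' :=
        ⟨min (E' - (E - ε)) (E + ε - E'), lt_min (by linarith [hE'.1]) (by linarith [hE'.2]),
          min_le_left _ _, min_le_right _ _⟩
      -- Chosen so that `i a = E' - i δ/2`, with negative real part of a as the Laplace transform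
      -- needs.
      set a : ℂ := ⟨-(δ / 2), -E'⟩ with ha_def
      have ha : a.re < 0 := by
        simp only [ha_def]; linarith
      have hIa : Complex.I * a = ⟨E', -(δ / 2)⟩ := by
        apply Complex.ext <;> simp [ha_def]
      have hspec : ∀ Λ, Λ₀ ⊆ Λ → ∀ s ∈ spectrum ℝ (Φ.hamiltonian Λ),
          δ ≤ ‖(s : ℂ) - (Φ.groundEnergy Λ + Complex.I * a)‖ := by
        intro Λ hΛ s hs
        have h1 : s - Φ.groundEnergy Λ ∉ Set.Ioo (E - ε) (E + ε) := fun hmem =>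
          Set.eq_empty_iff_forall_notMem.1 (hgap Λ hΛ) s ⟨⟨_, hmem, by simp⟩, hs⟩
        -- The horizontal distance alone is at least δ, because `s - E_Λ` lies outside the gap.
        refine le_trans ?_ (Complex.abs_re_le_norm _)
        rw [hIa]
        simp only [Complex.sub_re, Complex.add_re, Complex.ofReal_re]
        rw [le_abs]
        by_contra! hcon
        exact h1 ⟨by linarith [hcon.2], by linarith [hcon.1]⟩
      have hbound := norm_laplaceResolvent_le_of_gap G hτ hcont hU'
        (fun t A => apply_orbitMap_of_implements G (hU'.mem_unitary t) (hΩ t) (himp t A)) ha hδ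
        (sq_mul_apply_integral_globalDynamics_le hτ hψ hωΛ hω ha hδ.le hspec)
      have hmem : (E' : ℂ) ∈ unboundedResolventSet (generator U') := by
        -- The point `i a` is at distance δ/2 from `E'` and the resolvent there is at most `δ⁻¹`:
        -- the product 1/2 is below 1.
        refine mem_unboundedResolventSet_of_norm_lt (z := Complex.I * a)
          (generator_laplaceResolvent hU' a ha) (laplaceResolvent_generator hU' a ha) ?_
        have h2 : ‖(E' : ℂ) - Complex.I * a‖ = δ / 2 := by
          have h3 : (E' : ℂ) - Complex.I * a = Complex.I * ((δ / 2 : ℝ) : ℂ) := by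
            rw [hIa]
            apply Complex.ext <;> simp
          rw [h3, norm_mul, Complex.norm_I, one_mul, Complex.norm_real, Real.norm_of_nonneg
            (by positivity)]
        rw [norm_smul, h2]
        calc δ / 2 * ‖laplaceResolvent hU' a ha‖ ≤ δ / 2 * δ⁻¹ := by gcongr
          _ = 1 / 2 := by field_simp
          _ < 1 := by norm_num
      exact fun hn => hn hmem
    exact ⟨key E ⟨by linarith, by linarith⟩, key⟩
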